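/- **Conventions.** Let $n\ge 0$ be an integer and let $W$ be one of the groups $W_{A_{n-1}}=S_n$, $W_{B_n}$ (all signed permutations of $1,\dots,n$), $W_{D_n}$ (signed permutations with an even number of sign changes), acting on $\mathbb C^n$ by signed permutations of the standard basis. Write $s_{ij}$ for the transposition of $i$ and $j$, $\tau_i$ for the sign change at $i$, and $\overline s_{ij}=\tau_i\tau_js_{ij}$. Let $\mathcal C_n$ be the Clifford algebra generated by $c_1,\dots,c_n$ with $c_i^2=1$, $c_ic_j=-c_jc_i$ ($i\ne j$), and let $K=\mathcal C_n\rtimes\mathbb CW$. Let $u,v\in\mathbb C$. The rational double affine Hecke-Clifford algebra $\mathfrak H_W$ is the $\mathbb C$-algebra generated by $x_i,y_i,c_i$ $(1\le i\le n)$ and $W$, subject to the relations of $\mathcal C_n$ and of the group $W$, to $$x_ix_j=x_jx_i,\quad y_iy_j=y_jy_i,\quad y_ic_j=c_jy_i\ (\forall i,j),\quad x_ic_i=-c_ix_i,\quad x_ic_j=c_jx_i\ (i\neq j),$$ $$wx_iw^{-1}=w(x_i),\quad wy_iw^{-1}=w(y_i),\quad wc_iw^{-1}=w(c_i)\quad (w\in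 W),$$ and to the following relations. * Type $A_{n-1}$: $[y_j,x_i]=u(1+c_jc_i)s_{ji}$ for $i\ne j$, and $[y_i,x_i]=-u\sum_{k\ne i}(1+c_kc_i)s_{ki}$. * Type $D_n$: $[y_j,x_i]=u\big((1+c_jc_i)s_{ij}-(1-c_jc_i)\overline s_{ij}\big)$ for $i\neq j$, and $[y_i,x_i]=-u\sum_{k\ne i}\big((1+c_kc_i)s_{ki}+(1-c_kc_i)\overline s_{ki}\big)$. * Type $B_n$: $[y_j,x_i]$ for $i\ne j$ as in type $D_n$, and $[y_i,x_i]=-u\sum_{k\ne i}\big((1+c_kc_i)s_{ki}+(1-c_kc_i)\overline s_{ki}\big)-\sqrt2\,v\,\tau_i$. Let $\mathfrak H_y\subset\mathfrak H_W$ be the subalgebra generated by all $c_i$, $W$ and all $y_i$. **Theorem.** Let $M$ be a $K$-module. Then $M$ extends in a unique way to an $\mathfrak H_y$-module on which every $y_i$ acts by zero. Let $M_y=\mathfrak H_W\otimes_{\mathfrak H_y}M$ be the induced module. The map $f\otimes m\mapsto f(x)\otimes m$ is a linear isomorphism $\mathbb C[x_1,\dots,x_n]\otimes M\to M_y$. In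 terms of this identification, $x_i$ acts by multiplication on the first factor, and $K$ acts by the twisted diagonal action $$w\circ(f\otimes m)=f^w\otimes wm,\qquad c_i\circ (f\otimes m)=f|_{x_i\mapsto -x_i}\otimes c_im .$$ Moreover $y_i$ acts by the following Dunkl operators, where $f\in\mathbb C[x_1,\dots,x_n]$, $m\in M$, and $(g\,c_kc_i)\otimes m'$ stands for $g\otimes c_kc_im'$ when $g$ is a polynomial. * Type $A_{n-1}$: $$y_i\circ(f\otimes m)=-u\sum_{k\ne i}\left(\frac{f-f^{s_{ki}}}{x_i-x_k}+\frac{f\,c_kc_i-c_kc_i\,f^{s_{ki}}}{x_i+x_k}\right)\otimes s_{ki}m,$$ where $c_kc_i\,f^{s_{ki}}=\big(f^{s_{ki}}|_{x_i\mapsto-x_i,\;x_k\mapsto-x_k}\big)c_kc_i$. * Type $B_n$: $$\begin{aligned}y_i\circ(f\otimes m)=&-u\sum_{k\ne i}\left(\frac{f-f^{s_{ki}}}{x_i-x_k}+\frac{f-f^{\overline s_{ki}}}{x_i+x_k}c_kc_i\right)\otimes s_{ki}m\\&-u\sum_{k\ne i}\left(\frac{f-f^{\overline s_{ki}}}{x_i+x_k}-\frac{f-f^{s_{ki}}}{x_i-x_k}c_kc_i\right)\otimes\overline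 s_{ki}m-\sqrt2\,v\,\frac{f-f^{\tau_i}}{2x_i}\otimes\tau_im.\end{aligned}$$ * Type $D_n$: the formula of type $B_n$ without the last term, that is $$\begin{aligned}y_i\circ(f\otimes m)=&-u\sum_{k\ne i}\left(\frac{f-f^{s_{ki}}}{x_i-x_k}+\frac{f-f^{\overline s_{ki}}}{x_i+x_k}c_kc_i\right)\otimes s_{ki}m\\&-u\sum_{k\ne i}\left(\frac{f-f^{\overline s_{ki}}}{x_i+x_k}-\frac{f-f^{s_{ki}}}{x_i-x_k}c_kc_i\right)\otimes\overline s_{ki}m.\end{aligned}$$ All fractions are exact quotients of polynomials. -/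

import Mathlib

open scoped TensorProduct

namespace DaHCa

/-! ### Signed permutations and the classical Weyl groups -/

/-- The group of signed permutations of `1, …, n`. The element `(ε, σ)` acts on `ℂⁿ` by
`e_j ↦ ε (σ j) e_{σ j}`. -/
abbrev SignedPerm (n : ℕ) : Type :=
  (Fin n → ℤˣ) ⋊[mulAutArrow (G := Equiv.Perm (Fin n)) (A := Fin n) (M := ℤˣ)] Equiv.Perm (Fin n)

variable {n : ℕ}

namespace SignedPerm

/-- The underlying permutation `σ` of `g = (ε, σ)`. -/
def perm (g : SignedPerm n) : Equiv.Perm (Fin n) := g.right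

/-- The sign with which `g` sends `e_j` to `± e_{σ j}`. -/
def sgn (g : SignedPerm n) (j : Fin n) : ℂ := ((g.left (g.right j) : ℤ) : ℂ)

/-- The transposition `s_{ij} = (i, j)`. -/
def s (i j : Fin n) : SignedPerm n := SemidirectProduct.inr (Equiv.swap i j)

/-- The sign change `τ_i` at `i`. -/
def tau (i : Fin n) : SignedPerm n := SemidirectProduct.inl (Pi.mulSingle i (-1))

/-- The transposition of `i` and `j` coupled with the sign changes at `i` and `j` (for `i ≠ j`). -/
def sBar (i j : Fin n) : SignedPerm n := tau i * tau j * s i j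

end SignedPerm

open SignedPerm

/-- `W_{A_{n-1}} = S_n`: no signs. -/
def weylA (n : ℕ) : Subgroup (SignedPerm n) := (SemidirectProduct.inr).range

/-- `W_{B_n}`: all signed permutations. -/
def weylB (n : ℕ) : Subgroup (SignedPerm n) := ⊤

/-- `W_{D_n}`: the signed permutations with an even number of signs. -/
def weylD (n : ℕ) : Subgroup (SignedPerm n) where
  carrier := {g | ∏ i, g.left i = 1}
  one_mem' := by simp
  mul_mem' := by
    intro a b ha hb
    simp only [Set.mem_ofPred_eq, SemidirectProduct.mul_left, Pi.mul_apply,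
      Finset.prod_mul_distrib] at *
    rw [ha, one_mul, ← hb]
    exact Equiv.prod_comp (a.right⁻¹) b.left
  inv_mem' := by
    intro a ha
    simp only [Set.mem_ofPred_eq, SemidirectProduct.inv_left] at *
    have h : ∏ i, (a.left⁻¹) i = 1 := by
      simp only [Pi.inv_apply, Finset.prod_inv_distrib, ha, inv_one]
    rw [← h]
    exact Equiv.prod_comp (a.right⁻¹⁻¹) (a.left⁻¹)

/-- The elements `s_{ij}`, `s̄_{ij}`, `τ_i` as elements of the Weyl groups. -/
def sA (i j : Fin n) : weylA n := ⟨s i j, ⟨_, rfl⟩⟩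
def sB (i j : Fin n) : weylB n := ⟨s i j, trivial⟩
def sBarB (i j : Fin n) : weylB n := ⟨sBar i j, trivial⟩
def tauB (i : Fin n) : weylB n := ⟨tau i, trivial⟩
def sD (i j : Fin n) : weylD n := ⟨s i j, by
  show ∏ k, (s i j).left k = 1
  simp [s]⟩
def sBarD (i j : Fin n) : weylD n := ⟨sBar i j, by
  show ∏ k, (sBar i j).left k = 1
  simp [sBar, s, tau, Finset.prod_mul_distrib]⟩

/-! ### The algebra `K = C_n ⋊ ℂW` -/

noncomputable section

/-- Generators of `K`: the Clifford generators `c_i` and the elements of `W`. -/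
inductive KGen (W : Subgroup (SignedPerm n)) : Type
  | c (i : Fin n)
  | w (g : W)

/-- Defining relations of `K = C_n ⋊ ℂW`. -/
inductive KRel (W : Subgroup (SignedPerm n)) :
    FreeAlgebra ℂ (KGen W) → FreeAlgebra ℂ (KGen W) → Prop
  | c_sq (i : Fin n) : KRel W (FreeAlgebra.ι ℂ (.c i) * FreeAlgebra.ι ℂ (.c i)) 1
  | c_anti (i j : Fin n) (h : i ≠ j) :
      KRel W (FreeAlgebra.ι ℂ (.c i) * FreeAlgebra.ι ℂ (.c j))
        (-(FreeAlgebra.ι ℂ (.c j) * FreeAlgebra.ι ℂ (.c i)))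
  | w_one : KRel W (FreeAlgebra.ι ℂ (.w 1)) 1
  | w_mul (g h : W) :
      KRel W (FreeAlgebra.ι ℂ (.w g) * FreeAlgebra.ι ℂ (.w h)) (FreeAlgebra.ι ℂ (.w (g * h)))
  | w_c (g : W) (i : Fin n) :
      KRel W (FreeAlgebra.ι ℂ (.w g) * FreeAlgebra.ι ℂ (.c i) * FreeAlgebra.ι ℂ (.w g⁻¹))
        (sgn (g : SignedPerm n) i • FreeAlgebra.ι ℂ (.c (perm (g : SignedPerm n) i)))

/-- The semidirect product `K = C_n ⋊ ℂW` of the Clifford algebra and the group algebra. -/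
def K (W : Subgroup (SignedPerm n)) : Type := RingQuot (KRel W)

instance (W : Subgroup (SignedPerm n)) : Ring (K W) := inferInstanceAs (Ring (RingQuot (KRel W)))
instance (W : Subgroup (SignedPerm n)) : Algebra ℂ (K W) :=
  inferInstanceAs (Algebra ℂ (RingQuot (KRel W)))

namespace K

variable {W : Subgroup (SignedPerm n)}

/-- The Clifford generator `c_i` in `K`. -/
def c (i : Fin n) : K W := RingQuot.mkAlgHom ℂ (KRel W) (FreeAlgebra.ι ℂ (.c i))

/-- The element `g ∈ W` in `K`. -/
def w (g : W) : K W := RingQuot.mkAlgHom ℂ (KRel W) (FreeAlgebra.ι ℂ (.w g))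

end K

/-! ### The rational double affine Hecke-Clifford algebras -/

/-- Generators `x_i`, `y_i`, `c_i` and `W`. -/
inductive Gen (W : Subgroup (SignedPerm n)) : Type
  | x (i : Fin n)
  | y (i : Fin n)
  | c (i : Fin n)
  | w (g : W)

/-- The free algebra on the generators, in which the relations are written. -/
abbrev Free (W : Subgroup (SignedPerm n)) : Type := FreeAlgebra ℂ (Gen W)

namespace Free

variable {W : Subgroup (SignedPerm n)}

def x (i : Fin n) : Free W := FreeAlgebra.ι ℂ (.x i)
def y (i : Fin n) : Free W := FreeAlgebra.ι ℂ (.y i)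
def c (i : Fin n) : Free W := FreeAlgebra.ι ℂ (.c i)
def w (g : W) : Free W := FreeAlgebra.ι ℂ (.w g)

end Free

/-- Defining relations; `comm j i` is the prescribed value of `[y_j, x_i]`. -/
inductive Rel (W : Subgroup (SignedPerm n)) (comm : Fin n → Fin n → Free W) :
    Free W → Free W → Prop
  | c_sq (i : Fin n) : Rel W comm (Free.c i * Free.c i) 1
  | c_anti (i j : Fin n) (h : i ≠ j) : Rel W comm (Free.c i * Free.c j) (-(Free.c j * Free.c i))
  | x_comm (i j : Fin n) : Rel W comm (Free.x i * Free.x j) (Free.x j * Free.x i)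
  | y_comm (i j : Fin n) : Rel W comm (Free.y i * Free.y j) (Free.y j * Free.y i)
  | y_c (i j : Fin n) : Rel W comm (Free.y i * Free.c j) (Free.c j * Free.y i)
  | x_c_self (i : Fin n) : Rel W comm (Free.x i * Free.c i) (-(Free.c i * Free.x i))
  | x_c (i j : Fin n) (h : i ≠ j) : Rel W comm (Free.x i * Free.c j) (Free.c j * Free.x i)
  | w_one : Rel W comm (Free.w 1) 1
  | w_mul (g h : W) : Rel W comm (Free.w g * Free.w h) (Free.w (g * h))
  | w_x (g : W) (i : Fin n) : Rel W comm (Free.w g * Free.x i * Free.w g⁻¹)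
      (sgn (g : SignedPerm n) i • Free.x (perm (g : SignedPerm n) i))
  | w_y (g : W) (i : Fin n) : Rel W comm (Free.w g * Free.y i * Free.w g⁻¹)
      (sgn (g : SignedPerm n) i • Free.y (perm (g : SignedPerm n) i))
  | w_c (g : W) (i : Fin n) : Rel W comm (Free.w g * Free.c i * Free.w g⁻¹)
      (sgn (g : SignedPerm n) i • Free.c (perm (g : SignedPerm n) i))
  | y_x (j i : Fin n) : Rel W comm (Free.y j * Free.x i - Free.x i * Free.y j) (comm j i)

/-- The algebra on `x_i`, `y_i`, `c_i`, `W` with `[y_j, x_i] = comm j i`. -/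
def H (W : Subgroup (SignedPerm n)) (comm : Fin n → Fin n → Free W) : Type :=
  RingQuot (Rel W comm)

instance (W : Subgroup (SignedPerm n)) (comm : Fin n → Fin n → Free W) : Ring (H W comm) :=
  inferInstanceAs (Ring (RingQuot (Rel W comm)))
instance (W : Subgroup (SignedPerm n)) (comm : Fin n → Fin n → Free W) : Algebra ℂ (H W comm) :=
  inferInstanceAs (Algebra ℂ (RingQuot (Rel W comm)))

namespace H

variable {W : Subgroup (SignedPerm n)} {comm : Fin n → Fin n → Free W}

def x (i : Fin n) : H W comm := RingQuot.mkAlgHom ℂ (Rel W comm) (Free.x i)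
def y (i : Fin n) : H W comm := RingQuot.mkAlgHom ℂ (Rel W comm) (Free.y i)
def c (i : Fin n) : H W comm := RingQuot.mkAlgHom ℂ (Rel W comm) (Free.c i)
def w (g : W) : H W comm := RingQuot.mkAlgHom ℂ (Rel W comm) (Free.w g)

/-- The subalgebra `H_y` generated by `K` (that is, by all `c_i` and `W`) and all `y_i`. -/
def subY (W : Subgroup (SignedPerm n)) (comm : Fin n → Fin n → Free W) :
    Subalgebra ℂ (H W comm) :=
  Algebra.adjoin ℂ (Set.range c ∪ Set.range w ∪ Set.range y)

def subY.c (i : Fin n) : subY W comm :=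
  ⟨H.c i, Algebra.subset_adjoin (Or.inl (Or.inl ⟨i, rfl⟩))⟩
def subY.w (g : W) : subY W comm :=
  ⟨H.w g, Algebra.subset_adjoin (Or.inl (Or.inr ⟨g, rfl⟩))⟩
def subY.y (i : Fin n) : subY W comm :=
  ⟨H.y i, Algebra.subset_adjoin (Or.inr ⟨i, rfl⟩)⟩

end H

/-- The value of `[y_j, x_i]` in type `A_{n-1}`. -/
def commA (n : ℕ) (u : ℂ) (j i : Fin n) : Free (weylA n) :=
  if j = i then
    -(u • ∑ k with k ≠ i, (1 + Free.c k * Free.c i) * Free.w (sA k i))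
  else u • ((1 + Free.c j * Free.c i) * Free.w (sA j i))

/-- The value of `[y_j, x_i]` in type `D_n`. -/
def commD (n : ℕ) (u : ℂ) (j i : Fin n) : Free (weylD n) :=
  if j = i then
    -(u • ∑ k with k ≠ i, ((1 + Free.c k * Free.c i) * Free.w (sD k i)
      + (1 - Free.c k * Free.c i) * Free.w (sBarD k i)))
  else u • ((1 + Free.c j * Free.c i) * Free.w (sD i j)
      - (1 - Free.c j * Free.c i) * Free.w (sBarD i j))

/-- The value of `[y_j, x_i]` in type `B_n`. -/
def commB (n : ℕ) (u v : ℂ) (j i : Fin n) : Free (weylB n) :=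
  if j = i then
    -(u • ∑ k with k ≠ i, ((1 + Free.c k * Free.c i) * Free.w (sB k i)
      + (1 - Free.c k * Free.c i) * Free.w (sBarB k i)))
      - (((√2 : ℝ) : ℂ) * v) • Free.w (tauB i)
  else u • ((1 + Free.c j * Free.c i) * Free.w (sB i j)
      - (1 - Free.c j * Free.c i) * Free.w (sBarB i j))

/-! ### Induced modules -/

section Induced

variable {A : Type*} [Ring A] [Algebra ℂ A] {M : Type*} [AddCommGroup M] [Module ℂ M]

/-- The `A`-submodule of `A ⊗_ℂ M` generated by all `as ⊗ m - a ⊗ sm` with `s ∈ S`. -/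
def indRel (S : Subalgebra ℂ A) (ρ : S →ₐ[ℂ] Module.End ℂ M) : Submodule A (A ⊗[ℂ] M) :=
  Submodule.span A {t | ∃ (a : A) (s : S) (m : M), t = (a * (s : A)) ⊗ₜ[ℂ] m - a ⊗ₜ[ℂ] (ρ s m)}

/-- The induced `A`-module `A ⊗_S M` of the `S`-module `(M, ρ)`. -/
abbrev Ind (S : Subalgebra ℂ A) (ρ : S →ₐ[ℂ] Module.End ℂ M) : Type _ :=
  (A ⊗[ℂ] M) ⧸ indRel S ρ

/-- The class of `a ⊗ m` in `A ⊗_S M`. -/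
def Ind.tmul (S : Subalgebra ℂ A) (ρ : S →ₐ[ℂ] Module.End ℂ M) (a : A) (m : M) : Ind S ρ :=
  Submodule.Quotient.mk (a ⊗ₜ[ℂ] m)

end Induced

/-! ### Actions on polynomials and divided differences -/

open MvPolynomial

/-- `f ↦ f^g`, the action of a signed permutation on `ℂ[x_1, …, x_n]`. -/
def polyAct (g : SignedPerm n) : MvPolynomial (Fin n) ℂ →ₐ[ℂ] MvPolynomial (Fin n) ℂ :=
  aeval fun j => C (sgn g j) * X (perm g j)

/-- The substitution `x_i ↦ -x_i`, which describes how `c_i` moves past a polynomial: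
`c_i f = (twist i f) c_i`. -/
def twist (i : Fin n) : MvPolynomial (Fin n) ℂ →ₐ[ℂ] MvPolynomial (Fin n) ℂ :=
  aeval fun j => if j = i then -X j else X j

theorem dvd_sub_of_dvd_X (q : MvPolynomial (Fin n) ℂ)
    (φ : MvPolynomial (Fin n) ℂ →ₐ[ℂ] MvPolynomial (Fin n) ℂ)
    (h : ∀ j, q ∣ X j - φ (X j)) (f : MvPolynomial (Fin n) ℂ) : q ∣ f - φ f := by
  induction f using MvPolynomial.induction_on with
  | C a => simp [show φ (C a) = C a from φ.commutes a]
  | add p r hp hr =>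
    have : p + r - φ (p + r) = (p - φ p) + (r - φ r) := by rw [map_add]; ring
    rw [this]; exact dvd_add hp hr
  | mul_X p j hp =>
    have : p * X j - φ (p * X j) = (p - φ p) * X j + φ p * (X j - φ (X j)) := by
      rw [map_mul]; ring
    rw [this]; exact dvd_add (hp.mul_right _) ((h j).mul_left _)

theorem polyAct_s_X (k i j : Fin n) : polyAct (s k i) (X j) = X (Equiv.swap k i j) := by
  simp [polyAct, perm, sgn, s]

theorem polyAct_tau_X (i j : Fin n) : polyAct (tau i) (X j) = if j = i then -X j else X j := by
  by_cases h : j = i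
  · subst h; simp [polyAct, perm, sgn, tau]
  · simp [polyAct, perm, sgn, tau, h]

theorem polyAct_mul (g h : SignedPerm n) (f : MvPolynomial (Fin n) ℂ) :
    polyAct (g * h) f = polyAct g (polyAct h f) := by
  suffices polyAct (g * h) = (polyAct g).comp (polyAct h) by rw [this]; rfl
  refine MvPolynomial.algHom_ext fun j => ?_
  have hC : ∀ a : ℂ, polyAct g (C a) = C a := fun a => (polyAct g).commutes a
  simp only [polyAct, aeval_X, AlgHom.comp_apply, map_mul] at hC ⊢
  rw [hC]
  simp only [perm, sgn, SemidirectProduct.mul_left, SemidirectProduct.mul_right, Pi.mul_apply,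
    Equiv.Perm.mul_apply, ← mul_assoc, ← map_mul]
  congr 2
  have : (mulAutArrow (A := Fin n) g.right) h.left (g.right (h.right j)) = h.left (h.right j) := by
    show h.left (g.right⁻¹ • (g.right (h.right j))) = _
    simp
  rw [this]
  push_cast
  ring

theorem dvd_s (i k : Fin n) (f : MvPolynomial (Fin n) ℂ) :
    (X i - X k) ∣ f - polyAct (s k i) f := by
  refine dvd_sub_of_dvd_X _ _ (fun j => ?_) f
  rw [polyAct_s_X]
  rcases eq_or_ne j k with rfl | hk
  · rw [Equiv.swap_apply_left]; exact ⟨-1, by ring⟩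
  · rcases eq_or_ne j i with rfl | hi
    · rw [Equiv.swap_apply_right]
    · rw [Equiv.swap_apply_of_ne_of_ne hk hi]; simp

theorem dvd_twist (i k : Fin n) (f : MvPolynomial (Fin n) ℂ) :
    (X i + X k) ∣ f - twist k (twist i (polyAct (s k i) f)) := by
  refine dvd_sub_of_dvd_X _ ((twist k).comp ((twist i).comp (polyAct (s k i)))) (fun j => ?_) f
  simp only [AlgHom.comp_apply, polyAct_s_X]
  rcases eq_or_ne j k with rfl | hk
  · rcases eq_or_ne i j with rfl | hi
    · simp [twist]
    · rw [Equiv.swap_apply_left]; simp [twist, hi, add_comm]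
  · rcases eq_or_ne j i with rfl | hi
    · rw [Equiv.swap_apply_right]; simp [twist, hk.symm]
    · rw [Equiv.swap_apply_of_ne_of_ne hk hi]; simp [twist, hi, hk]

theorem polyAct_tau (i : Fin n) : polyAct (tau i) = twist i := by
  refine MvPolynomial.algHom_ext fun j => ?_
  rw [polyAct_tau_X]; simp [twist]

theorem dvd_sBar (i k : Fin n) (f : MvPolynomial (Fin n) ℂ) :
    (X i + X k) ∣ f - polyAct (sBar k i) f := by
  simpa only [sBar, polyAct_mul, polyAct_tau] using dvd_twist i k f

theorem dvd_tau (i : Fin n) (f : MvPolynomial (Fin n) ℂ) :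
    (2 * X i) ∣ f - polyAct (tau i) f := by
  refine dvd_sub_of_dvd_X _ _ (fun j => ?_) f
  rw [polyAct_tau_X]
  split_ifs with h
  · subst h; exact ⟨1, by ring⟩
  · simp

/-- `(f - f^{s_{ki}}) / (x_i - x_k)` (for `k ≠ i`): the polynomial `q` with
`f - f^{s_{ki}} = (x_i - x_k) q`. -/
def divS (i k : Fin n) (f : MvPolynomial (Fin n) ℂ) : MvPolynomial (Fin n) ℂ :=
  (dvd_s i k f).choose

/-- `(f - f^{s̄_{ki}}) / (x_i + x_k)` (for `k ≠ i`): the polynomial `q` with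
`f - f^{s̄_{ki}} = (x_i + x_k) q`. -/
def divSBar (i k : Fin n) (f : MvPolynomial (Fin n) ℂ) : MvPolynomial (Fin n) ℂ :=
  (dvd_sBar i k f).choose

/-- `(f - f^{τ_i}) / (2 x_i)`: the polynomial `q` with `f - f^{τ_i} = 2 x_i q`. -/
def divTau (i : Fin n) (f : MvPolynomial (Fin n) ℂ) : MvPolynomial (Fin n) ℂ :=
  (dvd_tau i f).choose

/-- The polynomial `q` (for `k ≠ i`) with
`q c_k c_i = (f c_k c_i - c_k c_i f^{s_{ki}}) / (x_i + x_k)`. Since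
`c_k c_i f^{s_{ki}} = (twist k (twist i f^{s_{ki}})) c_k c_i`, this means
`f - twist k (twist i f^{s_{ki}}) = (x_i + x_k) q`. -/
def divTwist (i k : Fin n) (f : MvPolynomial (Fin n) ℂ) : MvPolynomial (Fin n) ℂ :=
  (dvd_twist i k f).choose

/-! ### The module `M_y` and its realization on `ℂ[x_1, …, x_n] ⊗ M` -/

section Realization

variable {W : Subgroup (SignedPerm n)} {comm : Fin n → Fin n → Free W}
  {M : Type*} [AddCommGroup M] [Module ℂ M]

/-- The `H_y`-module structure `ρy` on `M` extends the `K`-module structure `ρ`, with all `y_i`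
acting by zero. -/
structure IsTrivialExt (ρ : K W →ₐ[ℂ] Module.End ℂ M)
    (ρy : H.subY W comm →ₐ[ℂ] Module.End ℂ M) : Prop where
  c : ∀ i, ρy (H.subY.c i) = ρ (K.c i)
  w : ∀ g, ρy (H.subY.w g) = ρ (K.w g)
  y : ∀ i, ρy (H.subY.y i) = 0

/-- `e` is the identification `ℂ[x_1, …, x_n] ⊗ M = Ind M`, `f ⊗ m ↦ f(x) ⊗ m`: it is the
linear isomorphism that sends `1 ⊗ m` to `1 ⊗ m` and turns left multiplication by `x_i` on
polynomials into the action of `x_i`. -/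
structure IsIdentification (ρy : H.subY W comm →ₐ[ℂ] Module.End ℂ M)
    (e : MvPolynomial (Fin n) ℂ ⊗[ℂ] M ≃ₗ[ℂ] Ind (H.subY W comm) ρy) : Prop where
  one : ∀ m : M, e (1 ⊗ₜ m) = Ind.tmul (H.subY W comm) ρy 1 m
  x_smul : ∀ (i : Fin n) (f : MvPolynomial (Fin n) ℂ) (m : M),
    (H.x i : H W comm) • e (f ⊗ₜ m) = e ((X i * f) ⊗ₜ m)

/-- For the `K`-module `(M, ρ)`: the extension of `M` to `H_y` with trivial action of the `y_i`
exists and is unique; the induced module `M_y = Ind M` is identified with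
`ℂ[x_1, …, x_n] ⊗ M`; and on the latter `K` acts by the twisted diagonal action and `y_i` acts
by `f ⊗ m ↦ D i f m`. -/
structure RealizedBy (comm : Fin n → Fin n → Free W) (ρ : K W →ₐ[ℂ] Module.End ℂ M)
    (D : Fin n → MvPolynomial (Fin n) ℂ → M → MvPolynomial (Fin n) ℂ ⊗[ℂ] M) : Prop where
  existsUnique_ext : ∃! ρy : H.subY W comm →ₐ[ℂ] Module.End ℂ M, IsTrivialExt ρ ρy
  realization : ∀ ρy : H.subY W comm →ₐ[ℂ] Module.End ℂ M, IsTrivialExt ρ ρy →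
    ∃ e : MvPolynomial (Fin n) ℂ ⊗[ℂ] M ≃ₗ[ℂ] Ind (H.subY W comm) ρy,
      IsIdentification ρy e ∧
      (∀ (g : W) (f : MvPolynomial (Fin n) ℂ) (m : M),
        (H.w g : H W comm) • e (f ⊗ₜ m) =
          e (polyAct (g : SignedPerm n) f ⊗ₜ ρ (K.w g) m)) ∧
      (∀ (i : Fin n) (f : MvPolynomial (Fin n) ℂ) (m : M),
        (H.c i : H W comm) • e (f ⊗ₜ m) = e (twist i f ⊗ₜ ρ (K.c i) m)) ∧
      (∀ (i : Fin n) (f : MvPolynomial (Fin n) ℂ) (m : M),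
        (H.y i : H W comm) • e (f ⊗ₜ m) = e (D i f m))

end Realization

end

end DaHCa

namespace DaHCa

open SignedPerm MvPolynomial

variable {n : ℕ}

noncomputable section

/-! ### Multiplication and conjugation of signed permutations -/

namespace SignedPerm

/-! The theorem contains a PBW-type statement: no relation of the algebra collapses `ℂ[x] ⊗ M`. It
is proved by constructing a representation of the algebra on `ℂ[x] ⊗ M` and comparing it with the
induced module.

On `ℂ[x] ⊗ M` let `x_i` act by multiplication, `K` by the twisted diagonal action and `y_i` by the
Dunkl operator `D_i`. Each `D_i` kills `1 ⊗ M`, and `[D_i, x_l]` is the action of the element `κ i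
l` of `K` that represents the prescribed bracket. These two properties determine `D_i`. They follow
from the twisted Leibniz rule for divided differences (`IsDunkl.dividedDifference`), summed over
reflections in `isDunkl_reflBracket`.

The remaining relations are identities between operators on `ℂ[x] ⊗ M`. Two operators that agree on
`1 ⊗ M` and pass every `x_k` by the same rule are equal (`ext_of_mul_X`), so everything reduces to
three properties of `κ`: it moves past `c_l` with the same sign as `x_i` does (`reflBracket_mul_c`),
it is equivariant under `W` (`IsEquivariant`), and it satisfies the Jacobi identity `[y_i, [y_j,
x_l]] = [y_j, [y_i, x_l]]` (`IsKVector.jacobi_reflBracket`). The last makes the Dunkl operators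
commute. The transpositions `s` (`ε = 1`) and their signed variants `s̄` (`ε = -1`) are treated
uniformly; only equivariance in types B and D needs both families at once.

In this representation the subalgebra generated by `K` and the `y_i` preserves `1 ⊗ M`, which yields
the trivial extension of `M`. Frobenius reciprocity then gives a map from the induced module to
`ℂ[x] ⊗ M`, and `f ⊗ m ↦ f(x) ⊗ m` is its inverse (`realizedBy_of_isRep`). -/

theorem sgn_mul_self (g : SignedPerm n) (j : Fin n) : sgn g j * sgn g j = 1 := by
  unfold sgn
  rw [← Int.cast_mul, ← Units.val_mul, Int.units_mul_self]
  simp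

theorem sgn_eq_one_or (g : SignedPerm n) (j : Fin n) : sgn g j = 1 ∨ sgn g j = -1 :=
  mul_self_eq_one_iff.mp (sgn_mul_self g j)

theorem perm_mul (g h : SignedPerm n) : perm (g * h) = perm g * perm h := rfl

theorem sgn_mul (g h : SignedPerm n) (j : Fin n) :
    sgn (g * h) j = sgn g (perm h j) * sgn h j := by
  have : (g * h).left ((g * h).right j) =
      g.left (g.right (h.right j)) * h.left (g.right⁻¹ (g.right (h.right j))) := rfl
  rw [sgn, this]
  simp [sgn, perm]

@[ext]
theorem ext_perm_sgn {g h : SignedPerm n} (hp : ∀ j, perm g j = perm h j)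
    (hs : ∀ j, sgn g j = sgn h j) : g = h := by
  have hr : g.right = h.right := Equiv.ext hp
  refine SemidirectProduct.ext (funext fun j => ?_) hr
  -- `sgn` reads the sign vector at the image index, so its component at `j` is the sign at the
  -- preimage of `j`.
  have := hs (g.right.symm j)
  simp only [sgn, ← hr, Equiv.apply_symm_apply] at this
  exact Units.ext (by exact_mod_cast this)

theorem perm_s (i j : Fin n) : perm (s i j) = Equiv.swap i j := rfl

theorem sgn_s (i j k : Fin n) : sgn (s i j) k = 1 := by simp [sgn, s]

theorem perm_tau (i : Fin n) : perm (tau i) = 1 := rfl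

theorem sgn_tau (i k : Fin n) : sgn (tau i) k = if k = i then -1 else 1 := by
  by_cases h : k = i
  · subst h; simp [sgn, tau]
  · simp [sgn, tau, h]

theorem perm_sBar (i j : Fin n) : perm (sBar i j) = Equiv.swap i j := rfl

/-- Distinct indices matter: for `i = j` the two sign changes cancel and `s̄` is the identity. -/
theorem sgn_sBar {i j : Fin n} (h : i ≠ j) (k : Fin n) :
    sgn (sBar i j) k = if k = i ∨ k = j then -1 else 1 := by
  simp only [sBar, sgn_mul, sgn_s, sgn_tau, perm_tau, perm_s, Equiv.Perm.one_apply]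
  rcases eq_or_ne k i with rfl | hi
  · simp [h.symm]
  · rcases eq_or_ne k j with rfl | hj
    · simp [h]
    · simp [Equiv.swap_apply_of_ne_of_ne hi hj, hi, hj]

theorem s_comm (i j : Fin n) : s i j = s j i := by
  simp [s, Equiv.swap_comm]

theorem sBar_comm (i j : Fin n) : sBar i j = sBar j i := by
  have : tau i * tau j = tau j * tau i := by simp only [tau, ← map_mul, mul_comm]
  rw [sBar, sBar, s_comm, this]

theorem swap_perm_comm (g : SignedPerm n) (i j k : Fin n) :
    perm g (Equiv.swap i j k) = Equiv.swap (perm g i) (perm g j) (perm g k) :=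
  ((perm g).injective.swap_apply i j k).symm

theorem mul_s_of_sgn_eq (g : SignedPerm n) {i j : Fin n} (h : sgn g i = sgn g j) :
    g * s i j = s (perm g i) (perm g j) * g := by
  ext k
  · simp [perm_mul, perm_s, swap_perm_comm]
  · simp only [sgn_mul, sgn_s, perm_s, one_mul, mul_one]
    rcases eq_or_ne k i with rfl | hi
    · simp [h]
    · rcases eq_or_ne k j with rfl | hj
      · simp [h]
      · simp [Equiv.swap_apply_of_ne_of_ne hi hj]

/-- The root `e_i - e_j` goes to a multiple of `e_{g i} + e_{g j}` when the two signs differ, so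
conjugation by `g` exchanges the two kinds of reflections. -/
theorem mul_s_of_sgn_ne (g : SignedPerm n) {i j : Fin n} (hij : i ≠ j)
    (h : sgn g i = -sgn g j) : g * s i j = sBar (perm g i) (perm g j) * g := by
  have hij' : perm g i ≠ perm g j := fun e => hij ((perm g).injective e)
  ext k
  · simp [perm_mul, perm_s, perm_sBar, swap_perm_comm]
  · simp only [sgn_mul, sgn_s, perm_s, sgn_sBar hij', mul_one, (perm g).injective.eq_iff]
    rcases eq_or_ne k i with rfl | hi
    · simp [h]
    · rcases eq_or_ne k j with rfl | hj
      · simp [h]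
      · simp [Equiv.swap_apply_of_ne_of_ne hi hj, hi, hj]

theorem mul_sBar_of_sgn_eq (g : SignedPerm n) {i j : Fin n} (hij : i ≠ j)
    (h : sgn g i = sgn g j) : g * sBar i j = sBar (perm g i) (perm g j) * g := by
  have hij' : perm g i ≠ perm g j := fun e => hij ((perm g).injective e)
  ext k
  · simp [perm_mul, perm_sBar, swap_perm_comm]
  · simp only [sgn_mul, sgn_sBar hij, perm_sBar, sgn_sBar hij', (perm g).injective.eq_iff]
    rcases eq_or_ne k i with rfl | hi
    · simp [h]
    · rcases eq_or_ne k j with rfl | hj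
      · simp [h]
      · simp [Equiv.swap_apply_of_ne_of_ne hi hj, hi, hj]

theorem mul_sBar_of_sgn_ne (g : SignedPerm n) {i j : Fin n} (hij : i ≠ j)
    (h : sgn g i = -sgn g j) : g * sBar i j = s (perm g i) (perm g j) * g := by
  ext k
  · simp [perm_mul, perm_s, perm_sBar, swap_perm_comm]
  · simp only [sgn_mul, sgn_s, perm_sBar, sgn_sBar hij]
    rcases eq_or_ne k i with rfl | hi
    · simp [h]
    · rcases eq_or_ne k j with rfl | hj
      · simp [h]
      · simp [Equiv.swap_apply_of_ne_of_ne hi hj, hi, hj]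

theorem mul_tau (g : SignedPerm n) (i : Fin n) : g * tau i = tau (perm g i) * g := by
  ext k
  · simp [perm_mul, perm_tau]
  · simp [sgn_mul, sgn_tau, perm_tau, (perm g).injective.eq_iff]

end SignedPerm

theorem sgn_weylA (g : weylA n) (i : Fin n) : sgn (g : SignedPerm n) i = 1 := by
  obtain ⟨_, σ, rfl⟩ := g
  simp [sgn]

/-! ### Relations in `K` -/

namespace K

variable {W : Subgroup (SignedPerm n)}

/-- The projection from the free algebra. -/
def mk (W : Subgroup (SignedPerm n)) : FreeAlgebra ℂ (KGen W) →ₐ[ℂ] K W :=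
  RingQuot.mkAlgHom ℂ (KRel W)

theorem mk_rel {a b : FreeAlgebra ℂ (KGen W)} (h : KRel W a b) : mk W a = mk W b :=
  RingQuot.mkAlgHom_rel ℂ h

theorem mk_c (i : Fin n) : mk W (FreeAlgebra.ι ℂ (.c i)) = c i := rfl

theorem mk_w (g : W) : mk W (FreeAlgebra.ι ℂ (.w g)) = w g := rfl

theorem c_mul_self (i : Fin n) : (c i : K W) * c i = 1 := by
  simpa [mk_c] using mk_rel (KRel.c_sq (W := W) i)

theorem c_mul_c {i j : Fin n} (h : i ≠ j) : (c i : K W) * c j = -(c j * c i) := by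
  simpa [mk_c] using mk_rel (KRel.c_anti (W := W) i j h)

theorem w_one : (w 1 : K W) = 1 := by
  simpa [mk_w] using mk_rel (KRel.w_one (W := W))

theorem w_mul (g h : W) : w g * w h = w (g * h) := by
  simpa [mk_w] using mk_rel (KRel.w_mul (W := W) g h)

theorem w_inv_mul (g : W) : w g⁻¹ * w g = 1 := by rw [w_mul, inv_mul_cancel, w_one]

theorem w_mul_inv (g : W) : w g * w g⁻¹ = 1 := by rw [w_mul, mul_inv_cancel, w_one]

theorem w_mul_c (g : W) (i : Fin n) :
    w g * c i = sgn (g : SignedPerm n) i • (c (perm (g : SignedPerm n) i) * w g) := by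
  have : w g * c i * w g⁻¹ = sgn (g : SignedPerm n) i • c (perm (g : SignedPerm n) i) := by
    simpa [mk_w, mk_c] using mk_rel (KRel.w_c (W := W) g i)
  rw [← smul_mul_assoc, ← this, mul_assoc, w_inv_mul, mul_one]

/-- Algebra homomorphisms out of `K`. -/
def lift {A : Type*} [Ring A] [Algebra ℂ A] (γ : Fin n → A) (ω : W → A)
    (h₁ : ∀ i, γ i * γ i = 1) (h₂ : ∀ i j, i ≠ j → γ i * γ j = -(γ j * γ i))
    (h₃ : ω 1 = 1) (h₄ : ∀ g h, ω g * ω h = ω (g * h))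
    (h₅ : ∀ g i, ω g * γ i = sgn (g : SignedPerm n) i • (γ (perm (g : SignedPerm n) i) * ω g)) :
    K W →ₐ[ℂ] A :=
  RingQuot.liftAlgHom ℂ ⟨FreeAlgebra.lift ℂ fun | .c i => γ i | .w g => ω g, by
    intro a b h
    cases h with
    | c_sq i => simpa using h₁ i
    | c_anti i j h => simpa using h₂ i j h
    | w_one => simpa using h₃
    | w_mul g h => simpa using h₄ g h
    | w_c g i =>
      have : ω g * γ i * ω g⁻¹ =
          sgn (g : SignedPerm n) i • γ (perm (g : SignedPerm n) i) := by
        rw [h₅, smul_mul_assoc, mul_assoc, h₄, mul_inv_cancel, h₃, mul_one]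
      simpa using this⟩

section lift

variable {A : Type*} [Ring A] [Algebra ℂ A] (γ : Fin n → A) (ω : W → A)
    (h₁ : ∀ i, γ i * γ i = 1) (h₂ : ∀ i j, i ≠ j → γ i * γ j = -(γ j * γ i))
    (h₃ : ω 1 = 1) (h₄ : ∀ g h, ω g * ω h = ω (g * h))
    (h₅ : ∀ g i, ω g * γ i = sgn (g : SignedPerm n) i • (γ (perm (g : SignedPerm n) i) * ω g))

theorem lift_c (i : Fin n) : lift γ ω h₁ h₂ h₃ h₄ h₅ (c i) = γ i :=
  (RingQuot.liftAlgHom_mkAlgHom_apply ℂ _ _ _).trans (by simp)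

theorem lift_w (g : W) : lift γ ω h₁ h₂ h₃ h₄ h₅ (w g) = ω g :=
  (RingQuot.liftAlgHom_mkAlgHom_apply ℂ _ _ _).trans (by simp)

end lift

end K

/-! ### The brackets `[y_j, x_i]` -/

section Bracket

variable {A : Type*} [Ring A] [Algebra ℂ A]

/-- The element `(1 + ε c_k c_i) r_{ki}`. -/
def reflTerm (ε : ℂ) (γ : Fin n → A) (r : Fin n → Fin n → A) (k i : Fin n) : A :=
  (1 + ε • (γ k * γ i)) * r k i

/-- The contribution to `[y_j, x_i]` of a family of reflections `r_{ki}`. -/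
def reflBracket (ε : ℂ) (γ : Fin n → A) (r : Fin n → Fin n → A) (j i : Fin n) : A :=
  if j = i then -∑ k with k ≠ i, reflTerm ε γ r k i else ε • reflTerm ε γ r j i

/-- The contribution to `[y_j, x_i]` of a family of elements `t_i`. -/
def diagBracket (t : Fin n → A) (j i : Fin n) : A := if j = i then t i else 0

theorem map_reflTerm {B : Type*} [Ring B] [Algebra ℂ B] (F : A →ₐ[ℂ] B) (ε : ℂ) (γ : Fin n → A)
    (r : Fin n → Fin n → A) (k i : Fin n) :
    F (reflTerm ε γ r k i) = reflTerm ε (fun i => F (γ i)) (fun k i => F (r k i)) k i := by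
  simp [reflTerm]

theorem map_reflBracket {B : Type*} [Ring B] [Algebra ℂ B] (F : A →ₐ[ℂ] B) (ε : ℂ) (γ : Fin n → A)
    (r : Fin n → Fin n → A) (j i : Fin n) :
    F (reflBracket ε γ r j i) = reflBracket ε (fun i => F (γ i)) (fun k i => F (r k i)) j i := by
  unfold reflBracket
  split_ifs <;> simp [map_reflTerm]

theorem map_diagBracket {B : Type*} [Ring B] [Algebra ℂ B] (F : A →ₐ[ℂ] B) (t : Fin n → A)
    (j i : Fin n) : F (diagBracket t j i) = diagBracket (fun i => F (t i)) j i := by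
  unfold diagBracket
  split_ifs <;> simp

end Bracket

/-! ### Reflection families and the brackets against the Clifford generators -/

variable {W : Subgroup (SignedPerm n)}

/-- `r k i` is the reflection that sends `e_k` to `ε e_i` and `e_i` to `ε e_k`. -/
structure IsReflFamily (ε : ℂ) (r : Fin n → Fin n → W) : Prop where
  mul_self : ε * ε = 1
  perm : ∀ k i, perm (r k i : SignedPerm n) = Equiv.swap k i
  sgn : ∀ k i, k ≠ i → ∀ j, sgn (r k i : SignedPerm n) j = if j = k ∨ j = i then ε else 1

theorem IsReflFamily.s {r : Fin n → Fin n → W} (h : ∀ k i, (r k i : SignedPerm n) = s k i) :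
    IsReflFamily 1 r where
  mul_self := one_mul 1
  perm k i := by rw [h, perm_s]
  sgn k i _ j := by rw [h, sgn_s, ite_self]

theorem IsReflFamily.sBar {r : Fin n → Fin n → W} (h : ∀ k i, (r k i : SignedPerm n) = sBar k i) :
    IsReflFamily (-1) r where
  mul_self := by norm_num
  perm k i := by rw [h, perm_sBar]
  sgn k i hki j := by rw [h, sgn_sBar hki]

/-- The sign in `c_l x_i = ± x_i c_l`. -/
def cSign (l i : Fin n) : ℂ := if l = i then -1 else 1

theorem K.c_mul_c_mul_c_left {k i : Fin n} (h : k ≠ i) : (K.c k * K.c i : K W) * K.c k = -K.c i := by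
  rw [K.c_mul_c h, neg_mul, mul_assoc, K.c_mul_self, mul_one]

theorem K.c_mul_c_mul_c_right (k i : Fin n) : (K.c k * K.c i : K W) * K.c i = K.c k := by
  rw [mul_assoc, K.c_mul_self, mul_one]

theorem K.c_mul_c_mul_c_of_ne {k i l : Fin n} (hk : l ≠ k) (hi : l ≠ i) :
    (K.c k * K.c i : K W) * K.c l = K.c l * (K.c k * K.c i) := by
  rw [mul_assoc, K.c_mul_c hi.symm, mul_neg, ← mul_assoc, K.c_mul_c hk.symm, neg_mul, neg_neg,
    mul_assoc]

/-- Only `l = i` produces a sign. There the reflection turns `c_i` into `ε c_k`, and `(1 + ε c_k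
c_i) ε c_k = -c_i (1 + ε c_k c_i)`. For `l = k` the analogous identity is `(1 + ε c_k c_i) ε c_i =
c_k (1 + ε c_k c_i)`, and any other `c_l` commutes with the even element `c_k c_i`. -/
theorem reflTerm_mul_c {ε : ℂ} {r : Fin n → Fin n → W} (hr : IsReflFamily ε r) {k i : Fin n}
    (hki : k ≠ i) (l : Fin n) :
    (reflTerm ε K.c (fun k i => K.w (r k i)) k i : K W) * K.c l =
      cSign l i • (K.c l * reflTerm ε K.c (fun k i => K.w (r k i)) k i) := by
  simp only [reflTerm, mul_assoc, K.w_mul_c, hr.perm, hr.sgn k i hki, cSign]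
  simp only [← mul_assoc, mul_smul_comm, ← smul_mul_assoc]
  congr 1
  simp only [smul_mul_assoc, add_mul, mul_add, one_mul, mul_one, mul_smul_comm]
  rcases eq_or_ne l i with rfl | hi
  · rw [Equiv.swap_apply_right, K.c_mul_c_mul_c_left hki, ← mul_assoc,
      K.c_mul_c_mul_c_left hki.symm]
    simp [smul_smul, hr.mul_self, add_comm]
  · rcases eq_or_ne l k with rfl | hk
    · rw [Equiv.swap_apply_left, K.c_mul_c_mul_c_right, ← mul_assoc, K.c_mul_self]
      simp [smul_smul, hr.mul_self, hi, add_comm]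
    · rw [Equiv.swap_apply_of_ne_of_ne hk hi, K.c_mul_c_mul_c_of_ne hk hi]
      simp [hi, hk]

theorem reflBracket_mul_c {ε : ℂ} {r : Fin n → Fin n → W} (hr : IsReflFamily ε r)
    (j i l : Fin n) :
    (reflBracket ε K.c (fun k i => K.w (r k i)) j i : K W) * K.c l =
      cSign l i • (K.c l * reflBracket ε K.c (fun k i => K.w (r k i)) j i) := by
  unfold reflBracket
  split_ifs with h
  · rw [neg_mul, mul_neg, smul_neg, Finset.sum_mul, Finset.mul_sum, Finset.smul_sum]
    congr 1
    refine Finset.sum_congr rfl fun k hk => ?_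
    exact reflTerm_mul_c hr (Finset.mem_filter.mp hk).2 l
  · rw [smul_mul_assoc, reflTerm_mul_c hr h, mul_smul_comm, smul_comm]

theorem diagBracket_tau_mul_c {t : Fin n → W} (ht : ∀ i, (t i : SignedPerm n) = tau i)
    (j i l : Fin n) :
    (diagBracket (fun i => K.w (t i)) j i : K W) * K.c l =
      cSign l i • (K.c l * diagBracket (fun i => K.w (t i)) j i) := by
  unfold diagBracket
  split_ifs with h
  · rw [K.w_mul_c, ht, perm_tau, sgn_tau]; rfl
  · simp

/-! ### Equivariance of the brackets under `W` -/

theorem w_mul_reflTerm {ε δ : ℂ} {g a b : W} {k i : Fin n} (hab : g * a = b * g)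
    (hδ : δ = ε * (sgn (g : SignedPerm n) k * sgn (g : SignedPerm n) i)) :
    (K.w g : K W) * ((1 + ε • (K.c k * K.c i)) * K.w a) =
      ((1 + δ • (K.c (perm (g : SignedPerm n) k) * K.c (perm (g : SignedPerm n) i))) * K.w b) *
        K.w g := by
  -- Conjugation multiplies `c_k c_i` by two signs. Their product turns `ε` into `δ`, which matches
  -- the change of reflection type when the signs differ.
  have hcc : (K.w g : K W) * (K.c k * K.c i) =
      (sgn (g : SignedPerm n) k * sgn (g : SignedPerm n) i) •
        (K.c (perm (g : SignedPerm n) k) * K.c (perm (g : SignedPerm n) i)) * K.w g := by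
    rw [← mul_assoc, K.w_mul_c, smul_mul_assoc, mul_assoc, K.w_mul_c, mul_smul_comm, smul_smul,
      ← mul_assoc, smul_mul_assoc]
  rw [← mul_assoc, mul_add, mul_one, mul_smul_comm, hcc, mul_assoc _ (K.w b), K.w_mul, ← hab,
    ← K.w_mul, ← mul_assoc, add_mul 1 _ (K.w g), one_mul, ← smul_mul_assoc, smul_smul, hδ]

theorem sum_ne_perm {A : Type*} [AddCommMonoid A] (σ : Equiv.Perm (Fin n)) (F : Fin n → A)
    (i : Fin n) : ∑ k with k ≠ i, F (σ k) = ∑ k with k ≠ σ i, F k := by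
  refine Finset.sum_equiv σ (fun k => ?_) fun _ _ => rfl
  simp

/-- `κ` is equivariant under conjugation by `W`. -/
def IsEquivariant (κ : Fin n → Fin n → K W) : Prop :=
  ∀ (g : W) (j i : Fin n), K.w g * κ j i =
    (sgn (g : SignedPerm n) j * sgn (g : SignedPerm n) i) •
      (κ (perm (g : SignedPerm n) j) (perm (g : SignedPerm n) i) * K.w g)

theorem IsEquivariant.smul {κ : Fin n → Fin n → K W} (h : IsEquivariant κ) (a : ℂ) :
    IsEquivariant fun j i => a • κ j i := fun g j i => by
  rw [mul_smul_comm, h, smul_mul_assoc, smul_comm]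

theorem IsEquivariant.add {κ κ' : Fin n → Fin n → K W} (h : IsEquivariant κ)
    (h' : IsEquivariant κ') : IsEquivariant fun j i => κ j i + κ' j i := fun g j i => by
  rw [mul_add, h, h', add_mul, smul_add]

theorem isEquivariant_diagBracket {t : Fin n → W} (ht : ∀ i, (t i : SignedPerm n) = tau i) :
    IsEquivariant (diagBracket fun i => (K.w (t i) : K W)) := by
  intro g j i
  unfold diagBracket
  simp only [(perm (g : SignedPerm n)).injective.eq_iff]
  split_ifs with h
  · subst h
    have : g * t j = t (perm (g : SignedPerm n) j) * g := by
      apply Subtype.ext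
      simp [ht, mul_tau]
    rw [sgn_mul_self, one_smul, K.w_mul, K.w_mul, this]
  · simp

/-- Without signs in `W`, the transpositions form a family stable under conjugation, so they need no
`s̄` companion. -/
theorem isEquivariant_reflBracket_s {r : Fin n → Fin n → W}
    (hr : ∀ k i, (r k i : SignedPerm n) = s k i)
    (hW : ∀ (g : W) (i : Fin n), sgn (g : SignedPerm n) i = 1) :
    IsEquivariant (reflBracket 1 K.c fun k i => (K.w (r k i) : K W)) := by
  intro g j i
  have key (k i : Fin n) : (K.w g : K W) * reflTerm 1 K.c (fun k i => K.w (r k i)) k i =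
      reflTerm 1 K.c (fun k i => K.w (r k i)) (perm (g : SignedPerm n) k)
        (perm (g : SignedPerm n) i) * K.w g := by
    refine w_mul_reflTerm (Subtype.ext ?_) (by simp [hW])
    simpa [hr] using mul_s_of_sgn_eq (g : SignedPerm n) (i := k) (j := i) (by simp [hW])
  unfold reflBracket
  simp only [(perm (g : SignedPerm n)).injective.eq_iff, hW, mul_one, one_smul]
  split_ifs with h
  · rw [mul_neg, neg_mul, Finset.mul_sum, ← sum_ne_perm, Finset.sum_mul]
    simp_rw [key]
  · exact key j i

/-- Neither family is stable alone: a `g` with opposite signs at `k` and `i` exchanges `(1 + c_k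
c_i) s` with `(1 - c_k c_i) s̄`. In the diagonal bracket the sum absorbs the exchange. Off the
diagonal the terms enter as a difference, and the exchange yields exactly the sign `-1` that
equivariance demands. -/
theorem isEquivariant_reflBracket_s_add_sBar {r r' : Fin n → Fin n → W}
    (hr : ∀ k i, (r k i : SignedPerm n) = s k i)
    (hr' : ∀ k i, (r' k i : SignedPerm n) = sBar k i) :
    IsEquivariant fun j i => (reflBracket 1 K.c fun k i => (K.w (r k i) : K W)) j i +
      (reflBracket (-1) K.c fun k i => (K.w (r' k i) : K W)) j i := by
  intro g j i
  set T : Fin n → Fin n → K W := reflTerm 1 K.c fun k i => K.w (r k i) with hT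
  set T' : Fin n → Fin n → K W := reflTerm (-1) K.c fun k i => K.w (r' k i) with hT'
  have key (k i : Fin n) (hki : k ≠ i) :
      (sgn (g : SignedPerm n) k * sgn (g : SignedPerm n) i = 1 ∧
        K.w g * T k i = T (perm (g : SignedPerm n) k) (perm (g : SignedPerm n) i) * K.w g ∧
        K.w g * T' k i = T' (perm (g : SignedPerm n) k) (perm (g : SignedPerm n) i) * K.w g) ∨
      (sgn (g : SignedPerm n) k * sgn (g : SignedPerm n) i = -1 ∧
        K.w g * T k i = T' (perm (g : SignedPerm n) k) (perm (g : SignedPerm n) i) * K.w g ∧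
        K.w g * T' k i = T (perm (g : SignedPerm n) k) (perm (g : SignedPerm n) i) * K.w g) := by
    have hk := sgn_eq_one_or (g : SignedPerm n) k
    have hi := sgn_eq_one_or (g : SignedPerm n) i
    have h : sgn (g : SignedPerm n) k = sgn (g : SignedPerm n) i ∨
        sgn (g : SignedPerm n) k = -sgn (g : SignedPerm n) i := by
      rcases hk with hk | hk <;> rcases hi with hi | hi <;> simp [hk, hi]
    rcases h with h | h
    · have hs : sgn (g : SignedPerm n) k * sgn (g : SignedPerm n) i = 1 := by
        rw [h, sgn_mul_self]
      refine Or.inl ⟨hs, w_mul_reflTerm (Subtype.ext ?_) (by rw [hs, mul_one]),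
        w_mul_reflTerm (Subtype.ext ?_) (by rw [hs, mul_one])⟩
      · simpa [hr] using mul_s_of_sgn_eq (g : SignedPerm n) h
      · simpa [hr'] using mul_sBar_of_sgn_eq (g : SignedPerm n) hki h
    · have hs : sgn (g : SignedPerm n) k * sgn (g : SignedPerm n) i = -1 := by
        rw [h, neg_mul, sgn_mul_self]
      refine Or.inr ⟨hs, w_mul_reflTerm (Subtype.ext ?_) (by rw [hs, one_mul]),
        w_mul_reflTerm (Subtype.ext ?_) (by rw [hs]; norm_num)⟩
      · simpa [hr, hr'] using mul_s_of_sgn_ne (g : SignedPerm n) hki h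
      · simpa [hr, hr'] using mul_sBar_of_sgn_ne (g : SignedPerm n) hki h
  unfold reflBracket
  simp only [(perm (g : SignedPerm n)).injective.eq_iff, ← hT, ← hT']
  split_ifs with h
  · subst h
    simp only [← neg_add, mul_neg, neg_mul, ← Finset.sum_add_distrib]
    rw [sgn_mul_self, one_smul, ← sum_ne_perm, Finset.mul_sum, Finset.sum_mul]
    congr 1
    refine Finset.sum_congr rfl fun k hk => ?_
    rcases key k j (Finset.mem_filter.mp hk).2 with ⟨-, h₁, h₂⟩ | ⟨-, h₁, h₂⟩
    · rw [mul_add, h₁, h₂, add_mul]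
    · rw [mul_add, h₁, h₂, add_mul, add_comm]
  · rcases key j i h with ⟨h₀, h₁, h₂⟩ | ⟨h₀, h₁, h₂⟩
    · simp [mul_add, add_mul, h₀, h₁, h₂]
    · simp [mul_add, add_mul, h₀, h₁, h₂, add_comm]

/-! ### The Jacobi identity -/

/-- The Jacobi identity for `y_i`, `y_j`, `x_l`, with `[y_j, x_l] = κ j l`. -/
def JacobiHolds {A : Type*} [Ring A] (Y : Fin n → A) (κ : Fin n → Fin n → A) : Prop :=
  ∀ i j l, Y i * κ j l - κ j l * Y i = Y j * κ i l - κ i l * Y j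

section Jacobi

variable {A : Type*} [Ring A]

theorem JacobiHolds.add_eq_add {Y : Fin n → A} {κ : Fin n → Fin n → A} (h : JacobiHolds Y κ)
    (i j l : Fin n) : Y i * κ j l + κ i l * Y j = Y j * κ i l + κ j l * Y i :=
  sub_eq_sub_iff_add_eq_add.mp (h i j l)

theorem JacobiHolds.add {Y : Fin n → A} {κ κ' : Fin n → Fin n → A} (h : JacobiHolds Y κ)
    (h' : JacobiHolds Y κ') : JacobiHolds Y fun j i => κ j i + κ' j i := fun i j l => by
  rw [mul_add, add_mul, mul_add, add_mul, add_sub_add_comm, h, h', add_sub_add_comm]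

variable [Algebra ℂ A]

theorem JacobiHolds.smul {Y : Fin n → A} {κ : Fin n → Fin n → A} (h : JacobiHolds Y κ) (a : ℂ) :
    JacobiHolds Y fun j i => a • κ j i := fun i j l => by
  simp only [mul_smul_comm, smul_mul_assoc, ← smul_sub]
  rw [h]

/-- The elements `Y i` commute with the `c_j` and are permuted up to signs by `W`. -/
structure IsKVector (φ : K W →ₐ[ℂ] A) (Y : Fin n → A) : Prop where
  c : ∀ i j, Y i * φ (K.c j) = φ (K.c j) * Y i
  w : ∀ g i, φ (K.w g) * Y i =
    sgn (g : SignedPerm n) i • (Y (perm (g : SignedPerm n) i) * φ (K.w g))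

variable {φ : K W →ₐ[ℂ] A} {Y : Fin n → A}

/-- `Y p` commutes with the Clifford factor, so only the reflection acts on it. -/
theorem IsKVector.mul_reflTerm (hY : IsKVector φ Y) {ε : ℂ} {r : Fin n → Fin n → W}
    (hr : IsReflFamily ε r) {k i : Fin n} (hki : k ≠ i) (p : Fin n) :
    Y p * φ (reflTerm ε K.c (fun k i => K.w (r k i)) k i) =
      (if p = k ∨ p = i then ε else 1) •
        (φ (reflTerm ε K.c (fun k i => K.w (r k i)) k i) * Y (Equiv.swap k i p)) := by
  have hw : Y p * φ (K.w (r k i)) =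
      (if p = k ∨ p = i then ε else 1) • (φ (K.w (r k i)) * Y (Equiv.swap k i p)) := by
    rw [hY.w, hr.perm, hr.sgn k i hki, smul_smul, Equiv.swap_apply_self]
    rcases eq_or_ne p k with rfl | hk
    · simp [hr.mul_self]
    · rcases eq_or_ne p i with rfl | hi
      · simp [hr.mul_self]
      · simp [Equiv.swap_apply_of_ne_of_ne hk hi, hk, hi]
  have hc : Y p * φ (1 + ε • (K.c k * K.c i)) = φ (1 + ε • (K.c k * K.c i)) * Y p := by
    simp only [map_add, map_one, map_smul, map_mul, mul_add, add_mul, mul_one, one_mul,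
      mul_smul_comm, smul_mul_assoc]
    rw [← mul_assoc, hY.c, mul_assoc, hY.c, mul_assoc]
  rw [reflTerm, map_mul, ← mul_assoc, hc, mul_assoc, hw, mul_smul_comm, mul_assoc]

/-- If `i`, `j`, `l` are distinct, `Y i` commutes with the term for `{j, l}` and `Y j` with that for
`{i, l}`, so both sides vanish. The substantial case is `l = j`, where a single term `T` of the
diagonal sum survives and both sides equal `T Y_i - ε T Y_j`. The case `l = i` is its mirror image.
-/
theorem IsKVector.jacobi_reflBracket (hY : IsKVector φ Y) {ε : ℂ} {r : Fin n → Fin n → W}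
    (hr : IsReflFamily ε r) :
    JacobiHolds Y fun j i => φ (reflBracket ε K.c (fun k i => K.w (r k i)) j i) := by
  have diag (i j : Fin n) (hij : i ≠ j) :
      Y i * φ (reflBracket ε K.c (fun k i => K.w (r k i)) j j) -
          φ (reflBracket ε K.c (fun k i => K.w (r k i)) j j) * Y i =
        Y j * φ (reflBracket ε K.c (fun k i => K.w (r k i)) i j) -
          φ (reflBracket ε K.c (fun k i => K.w (r k i)) i j) * Y j := by
    -- The term for `k ≠ i` involves only the indices `k` and `j`, hence commutes with `Y i`.
    have h₁ : ∑ k with k ≠ j, (Y i * φ (reflTerm ε K.c (fun k i => K.w (r k i)) k j) -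
          φ (reflTerm ε K.c (fun k i => K.w (r k i)) k j) * Y i) =
        Y i * φ (reflTerm ε K.c (fun k i => K.w (r k i)) i j) -
          φ (reflTerm ε K.c (fun k i => K.w (r k i)) i j) * Y i := by
      refine Finset.sum_eq_single_of_mem i (by simp [hij]) fun k hk hki => ?_
      have hkj := (Finset.mem_filter.mp hk).2
      rw [hY.mul_reflTerm hr hkj, Equiv.swap_apply_of_ne_of_ne hki.symm hij]
      simp [hki.symm, hij]
    have h₂ : φ (reflBracket ε K.c (fun k i => K.w (r k i)) j j) =
        -∑ k with k ≠ j, φ (reflTerm ε K.c (fun k i => K.w (r k i)) k j) := by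
      simp [reflBracket]
    have h₃ : φ (reflBracket ε K.c (fun k i => K.w (r k i)) i j) =
        ε • φ (reflTerm ε K.c (fun k i => K.w (r k i)) i j) := by
      simp [reflBracket, hij]
    rw [h₂, h₃, mul_neg, neg_mul, Finset.mul_sum, Finset.sum_mul, ← neg_sub', ← Finset.sum_sub_distrib,
      h₁, mul_smul_comm, hY.mul_reflTerm hr hij, hY.mul_reflTerm hr hij]
    simp [smul_smul, hr.mul_self]
  intro i j l
  rcases eq_or_ne i j with rfl | hij
  · rfl
  rcases eq_or_ne j l with rfl | hjl
  · exact diag i j hij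
  rcases eq_or_ne i l with rfl | hil
  · exact (diag j i hij.symm).symm
  simp only [reflBracket, hjl, hil, if_false, map_smul, mul_smul_comm, smul_mul_assoc]
  rw [hY.mul_reflTerm hr hjl, hY.mul_reflTerm hr hil, Equiv.swap_apply_of_ne_of_ne hij hil,
    Equiv.swap_apply_of_ne_of_ne hij.symm hjl]
  simp [hij, hij.symm, hil, hjl]

/-- For `i ≠ j` the element `τ_j` commutes with `Y i`, so both sides are zero. -/
theorem IsKVector.jacobi_diagBracket (hY : IsKVector φ Y) {t : Fin n → W}
    (ht : ∀ i, (t i : SignedPerm n) = tau i) :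
    JacobiHolds Y fun j i => φ (diagBracket (fun i => K.w (t i)) j i) := by
  have comm (i j : Fin n) (hij : i ≠ j) : Y i * φ (K.w (t j)) - φ (K.w (t j)) * Y i = 0 := by
    rw [hY.w, ht, perm_tau, sgn_tau]
    simp [hij]
  intro i j l
  rcases eq_or_ne i j with rfl | hij
  · rfl
  rcases eq_or_ne j l with rfl | hjl
  · simp [diagBracket, comm i j hij, hij]
  rcases eq_or_ne i l with rfl | hil
  · simp [diagBracket, comm j i hij.symm, hij.symm]
  simp [diagBracket, hjl, hil]

end Jacobi

/-! ### Actions on polynomials -/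

theorem polyAct_X (g : SignedPerm n) (j : Fin n) :
    polyAct g (X j) = sgn g j • (X (perm g j) : MvPolynomial (Fin n) ℂ) := by
  rw [polyAct, aeval_X, C_mul']

theorem twist_X (i j : Fin n) : twist i (X j) = cSign i j • (X j : MvPolynomial (Fin n) ℂ) := by
  rw [twist, aeval_X, cSign]
  rcases eq_or_ne i j with rfl | h
  · simp
  · simp [h, h.symm]

theorem cSign_mul_self (i j : Fin n) : cSign i j * cSign i j = 1 := by
  unfold cSign; split_ifs <;> norm_num

theorem twist_twist_self (i : Fin n) (f : MvPolynomial (Fin n) ℂ) : twist i (twist i f) = f := by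
  suffices (twist i).comp (twist i) = AlgHom.id ℂ _ from DFunLike.congr_fun this f
  refine algHom_ext fun j => ?_
  simp [twist_X, smul_smul, cSign_mul_self]

theorem twist_comm (i k : Fin n) (f : MvPolynomial (Fin n) ℂ) :
    twist i (twist k f) = twist k (twist i f) := by
  suffices (twist i).comp (twist k) = (twist k).comp (twist i) from DFunLike.congr_fun this f
  refine algHom_ext fun j => ?_
  simp [twist_X, smul_smul, mul_comm]

theorem polyAct_twist (g : SignedPerm n) (i : Fin n) (f : MvPolynomial (Fin n) ℂ) :
    polyAct g (twist i f) = twist (perm g i) (polyAct g f) := by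
  suffices (polyAct g).comp (twist i) = (twist (perm g i)).comp (polyAct g) from
    DFunLike.congr_fun this f
  refine algHom_ext fun j => ?_
  simp only [AlgHom.comp_apply, twist_X, polyAct_X, map_smul, smul_smul, mul_comm, cSign,
    (perm g).injective.eq_iff]

theorem polyAct_one (f : MvPolynomial (Fin n) ℂ) : polyAct (1 : SignedPerm n) f = f := by
  suffices polyAct (1 : SignedPerm n) = AlgHom.id ℂ _ from DFunLike.congr_fun this f
  refine algHom_ext fun j => ?_
  simp [polyAct_X, sgn, perm]

/-! ### Operators on `ℂ[x] ⊗ M` -/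

variable {M : Type*} [AddCommGroup M] [Module ℂ M]

/-- The twisted diagonal action of `K`. -/
def diagAct (ρ : K W →ₐ[ℂ] Module.End ℂ M) :
    K W →ₐ[ℂ] Module.End ℂ (MvPolynomial (Fin n) ℂ ⊗[ℂ] M) :=
  K.lift (fun i => TensorProduct.map (twist i).toLinearMap (ρ (K.c i)))
    (fun g => TensorProduct.map (polyAct (g : SignedPerm n)).toLinearMap (ρ (K.w g)))
    (fun i => by
      refine TensorProduct.ext' fun f m => ?_
      change twist i (twist i f) ⊗ₜ (ρ (K.c i) * ρ (K.c i)) m = f ⊗ₜ[ℂ] m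
      rw [twist_twist_self, ← map_mul, K.c_mul_self, map_one, Module.End.one_apply])
    (fun i j h => by
      refine TensorProduct.ext' fun f m => ?_
      change twist i (twist j f) ⊗ₜ (ρ (K.c i) * ρ (K.c j)) m =
        -(twist j (twist i f) ⊗ₜ[ℂ] (ρ (K.c j) * ρ (K.c i)) m)
      rw [twist_comm i j, ← map_mul, K.c_mul_c h, map_neg, LinearMap.neg_apply,
        TensorProduct.tmul_neg, map_mul])
    (by
      refine TensorProduct.ext' fun f m => ?_
      change polyAct 1 f ⊗ₜ ρ (K.w 1) m = f ⊗ₜ[ℂ] m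
      rw [polyAct_one, K.w_one, map_one, Module.End.one_apply])
    (fun g h => by
      refine TensorProduct.ext' fun f m => ?_
      change polyAct g (polyAct h f) ⊗ₜ (ρ (K.w g) * ρ (K.w h)) m =
        polyAct (g * h) f ⊗ₜ[ℂ] ρ (K.w (g * h)) m
      rw [Subgroup.coe_mul, polyAct_mul, ← map_mul, K.w_mul])
    (fun g i => by
      refine TensorProduct.ext' fun f m => ?_
      change polyAct g (twist i f) ⊗ₜ (ρ (K.w g) * ρ (K.c i)) m =
        sgn (g : SignedPerm n) i • (twist (perm (g : SignedPerm n) i) (polyAct g f) ⊗ₜ[ℂ]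
          (ρ (K.c (perm (g : SignedPerm n) i)) * ρ (K.w g)) m)
      rw [polyAct_twist, ← map_mul, K.w_mul_c, map_smul, map_mul, LinearMap.smul_apply,
        TensorProduct.tmul_smul])

theorem diagAct_c (ρ : K W →ₐ[ℂ] Module.End ℂ M) (i : Fin n) (f : MvPolynomial (Fin n) ℂ) (m : M) :
    diagAct ρ (K.c i) (f ⊗ₜ m) = twist i f ⊗ₜ ρ (K.c i) m := by
  rw [diagAct, K.lift_c]; rfl

theorem diagAct_w (ρ : K W →ₐ[ℂ] Module.End ℂ M) (g : W) (f : MvPolynomial (Fin n) ℂ) (m : M) :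
    diagAct ρ (K.w g) (f ⊗ₜ m) = polyAct (g : SignedPerm n) f ⊗ₜ ρ (K.w g) m := by
  rw [diagAct, K.lift_w]; rfl

/-- Multiplication by a polynomial on the first factor. -/
def polyMul (M : Type*) [AddCommGroup M] [Module ℂ M] :
    MvPolynomial (Fin n) ℂ →ₐ[ℂ] Module.End ℂ (MvPolynomial (Fin n) ℂ ⊗[ℂ] M) :=
  (Module.End.rTensorAlgHom ℂ (MvPolynomial (Fin n) ℂ) M).comp (Algebra.lmul ℂ _)

theorem polyMul_tmul (p f : MvPolynomial (Fin n) ℂ) (m : M) :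
    polyMul M p (f ⊗ₜ m) = (p * f) ⊗ₜ m := rfl

/-- Two operators on `ℂ[x] ⊗ M` that agree on `1 ⊗ M` and are moved past the `x_k` by the same rule
are equal. -/
theorem ext_of_mul_X {T T' : Module.End ℂ (MvPolynomial (Fin n) ℂ ⊗[ℂ] M)}
    (h₁ : ∀ m, T (1 ⊗ₜ m) = T' (1 ⊗ₜ m))
    (hX : ∀ k, ∃ R S : Module.End ℂ (MvPolynomial (Fin n) ℂ ⊗[ℂ] M),
      T * polyMul M (X k) = R * T + S ∧ T' * polyMul M (X k) = R * T' + S) : T = T' := by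
  refine TensorProduct.ext' fun f m => ?_
  induction f using MvPolynomial.induction_on with
  | C a =>
    have : (C a : MvPolynomial (Fin n) ℂ) = a • 1 := by rw [smul_eq_C_mul, mul_one]
    rw [this, ← TensorProduct.smul_tmul', map_smul, h₁, map_smul]
  | add p q hp hq => rw [TensorProduct.add_tmul, map_add, hp, hq, map_add]
  | mul_X p k hp =>
    obtain ⟨R, S, hR, hR'⟩ := hX k
    have h := LinearMap.congr_fun hR (p ⊗ₜ m)
    have h' := LinearMap.congr_fun hR' (p ⊗ₜ m)
    simp only [Module.End.mul_apply, LinearMap.add_apply, polyMul_tmul] at h h'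
    rw [mul_comm, h, h', hp]

/-- `T` is bilinear, kills constants, and `[T, x_l]` is the action of `κ l ∈ K`. -/
structure IsDunkl (ρ : K W →ₐ[ℂ] Module.End ℂ M) (κ : Fin n → K W)
    (T : MvPolynomial (Fin n) ℂ → M → MvPolynomial (Fin n) ℂ ⊗[ℂ] M) : Prop where
  add_left : ∀ f f' m, T (f + f') m = T f m + T f' m
  smul_left : ∀ (a : ℂ) f m, T (a • f) m = a • T f m
  add_right : ∀ f m m', T f (m + m') = T f m + T f m'
  smul_right : ∀ (a : ℂ) f m, T f (a • m) = a • T f m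
  one : ∀ m, T 1 m = 0
  X_mul : ∀ l f m, T (X l * f) m = polyMul M (X l) (T f m) + diagAct ρ (κ l) (f ⊗ₜ m)

/-! ### Linear combinations of Dunkl operators and divided differences -/

namespace IsDunkl

variable {ρ : K W →ₐ[ℂ] Module.End ℂ M} {κ κ' : Fin n → K W}
  {T T' : MvPolynomial (Fin n) ℂ → M → MvPolynomial (Fin n) ℂ ⊗[ℂ] M}

theorem add (h : IsDunkl ρ κ T) (h' : IsDunkl ρ κ' T') :
    IsDunkl ρ (fun l => κ l + κ' l) fun f m => T f m + T' f m where
  add_left f f' m := by rw [h.add_left, h'.add_left, add_add_add_comm]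
  smul_left a f m := by rw [h.smul_left, h'.smul_left, smul_add]
  add_right f m m' := by rw [h.add_right, h'.add_right, add_add_add_comm]
  smul_right a f m := by rw [h.smul_right, h'.smul_right, smul_add]
  one m := by rw [h.one, h'.one, add_zero]
  X_mul l f m := by
    rw [h.X_mul, h'.X_mul, add_add_add_comm, map_add, map_add, LinearMap.add_apply]

theorem smul (h : IsDunkl ρ κ T) (b : ℂ) :
    IsDunkl ρ (fun l => b • κ l) fun f m => b • T f m where
  add_left f f' m := by rw [h.add_left, smul_add]
  smul_left a f m := by rw [h.smul_left, smul_comm]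
  add_right f m m' := by rw [h.add_right, smul_add]
  smul_right a f m := by rw [h.smul_right, smul_comm]
  one m := by rw [h.one, smul_zero]
  X_mul l f m := by rw [h.X_mul, smul_add, map_smul, map_smul, LinearMap.smul_apply]

theorem zero : IsDunkl ρ (fun _ => 0) fun _ _ => 0 where
  add_left _ _ _ := (add_zero _).symm
  smul_left _ _ _ := (smul_zero _).symm
  add_right _ _ _ := (add_zero _).symm
  smul_right _ _ _ := (smul_zero _).symm
  one _ := rfl
  X_mul l f m := by simp

theorem sum {ι : Type*} (t : Finset ι) {κ : ι → Fin n → K W}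
    {T : ι → MvPolynomial (Fin n) ℂ → M → MvPolynomial (Fin n) ℂ ⊗[ℂ] M}
    (h : ∀ k ∈ t, IsDunkl ρ (κ k) (T k)) :
    IsDunkl ρ (fun l => ∑ k ∈ t, κ k l) fun f m => ∑ k ∈ t, T k f m := by
  classical
  induction t using Finset.induction_on with
  | empty => simpa using zero
  | insert a t ha ih =>
    simp only [Finset.sum_insert ha]
    exact (h a (Finset.mem_insert_self a t)).add
      (ih fun k hk => h k (Finset.mem_insert_of_mem hk))

/-- A divided difference `δ f = (f - φ f) / q`, tensored with an element of `K` acting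
through `φ` on polynomials. -/
theorem dividedDifference {q : MvPolynomial (Fin n) ℂ} (hq : q ≠ 0)
    (φ : MvPolynomial (Fin n) ℂ →ₐ[ℂ] MvPolynomial (Fin n) ℂ)
    {δ : MvPolynomial (Fin n) ℂ → MvPolynomial (Fin n) ℂ} (hδ : ∀ f, f - φ f = q * δ f)
    {b : K W} (hb : ∀ f m, diagAct ρ b (f ⊗ₜ m) = φ f ⊗ₜ ρ b m)
    {a : Fin n → ℂ} (ha : ∀ l, X l - φ (X l) = a l • q) :
    IsDunkl ρ (fun l => a l • b) fun f m => δ f ⊗ₜ ρ b m where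
  add_left f f' m := by
    rw [← TensorProduct.add_tmul]
    congr 1
    apply mul_left_cancel₀ hq
    rw [← hδ, mul_add, ← hδ, ← hδ, map_add]
    ring
  smul_left c f m := by
    rw [TensorProduct.smul_tmul']
    congr 1
    apply mul_left_cancel₀ hq
    rw [← hδ, mul_smul_comm, ← hδ, map_smul, smul_sub]
  add_right f m m' := by rw [map_add, TensorProduct.tmul_add]
  smul_right c f m := by rw [map_smul, TensorProduct.tmul_smul]
  one m := by
    have : δ 1 = 0 := by
      apply mul_left_cancel₀ hq
      rw [← hδ, map_one, sub_self, mul_zero]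
    rw [this, TensorProduct.zero_tmul]
  X_mul l f m := by
    rw [polyMul_tmul, map_smul, LinearMap.smul_apply, hb, TensorProduct.smul_tmul',
      ← TensorProduct.add_tmul]
    congr 1
    apply mul_left_cancel₀ hq
    -- The twisted Leibniz rule. After division by `q` the second term is `a l • φ f`, and `b` acts
    -- on the polynomial factor exactly through `φ`.
    have h : (X l * f - φ (X l * f) : MvPolynomial (Fin n) ℂ) =
        X l * (f - φ f) + (X l - φ (X l)) * φ f := by
      rw [map_mul]; ring
    rw [← hδ, h, hδ, ha, smul_mul_assoc, mul_add, mul_smul_comm]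
    ring

/-- The operator on `ℂ[x] ⊗ M`. -/
def toEnd (h : IsDunkl ρ κ T) : Module.End ℂ (MvPolynomial (Fin n) ℂ ⊗[ℂ] M) :=
  TensorProduct.lift (LinearMap.mk₂ ℂ T h.add_left h.smul_left h.add_right h.smul_right)

theorem toEnd_tmul (h : IsDunkl ρ κ T) (f : MvPolynomial (Fin n) ℂ) (m : M) :
    h.toEnd (f ⊗ₜ m) = T f m := rfl

theorem toEnd_mul_X (h : IsDunkl ρ κ T) (l : Fin n) :
    h.toEnd * polyMul M (X l) = polyMul M (X l) * h.toEnd + diagAct ρ (κ l) := by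
  refine TensorProduct.ext' fun f m => ?_
  rw [Module.End.mul_apply, LinearMap.add_apply, Module.End.mul_apply, polyMul_tmul, toEnd_tmul,
    toEnd_tmul, h.X_mul]

end IsDunkl

theorem diagAct_c_mul_X (ρ : K W →ₐ[ℂ] Module.End ℂ M) (i j : Fin n) :
    diagAct ρ (K.c i) * polyMul M (X j) =
      cSign i j • (polyMul M (X j) * diagAct ρ (K.c i)) := by
  refine TensorProduct.ext' fun f m => ?_
  simp only [Module.End.mul_apply, LinearMap.smul_apply, polyMul_tmul, diagAct_c, map_mul, twist_X,
    smul_mul_assoc, TensorProduct.smul_tmul']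

theorem diagAct_w_mul_X (ρ : K W →ₐ[ℂ] Module.End ℂ M) (g : W) (j : Fin n) :
    diagAct ρ (K.w g) * polyMul M (X j) =
      sgn (g : SignedPerm n) j •
        (polyMul M (X (perm (g : SignedPerm n) j)) * diagAct ρ (K.w g)) := by
  refine TensorProduct.ext' fun f m => ?_
  simp only [Module.End.mul_apply, LinearMap.smul_apply, polyMul_tmul, diagAct_w, map_mul,
    polyAct_X, smul_mul_assoc, TensorProduct.smul_tmul']

/-! ### Relations satisfied by the Dunkl operators -/

section Dunkl

variable {ρ : K W →ₐ[ℂ] Module.End ℂ M} {κ : Fin n → Fin n → K W}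
  {D : Fin n → MvPolynomial (Fin n) ℂ → M → MvPolynomial (Fin n) ℂ ⊗[ℂ] M}

theorem isKVector_dunkl (hc : ∀ j i l, κ j i * K.c l = cSign l i • (K.c l * κ j i))
    (hw : IsEquivariant κ) (hD : ∀ i, IsDunkl ρ (κ i) (D i)) :
    IsKVector (diagAct ρ) fun i => (hD i).toEnd where
  c i j := by
    -- Moving `x_k` to the left past `c_j` and `D_i`, in either order, costs `cSign j k` and leaves
    -- the bracket. In the order `D_i c_j` the bracket term carries that sign, and moving `κ i k`
    -- past `c_j` produces it again; its square is `1`.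
    refine ext_of_mul_X (fun m => ?_) fun k =>
      ⟨cSign j k • polyMul M (X k), diagAct ρ (K.c j) * diagAct ρ (κ i k), ?_, ?_⟩
    · simp [diagAct_c, IsDunkl.toEnd_tmul, (hD i).one]
    · have h := congrArg (diagAct ρ) (hc i k j)
      rw [map_mul, map_smul, map_mul] at h
      rw [mul_assoc, diagAct_c_mul_X, mul_smul_comm, ← mul_assoc, IsDunkl.toEnd_mul_X, add_mul, h,
        smul_add, mul_assoc, smul_smul, cSign_mul_self, one_smul, smul_mul_assoc]
    · rw [mul_assoc, IsDunkl.toEnd_mul_X, mul_add, ← mul_assoc, diagAct_c_mul_X, smul_mul_assoc,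
        mul_assoc, smul_mul_assoc]
  w g i := by
    refine ext_of_mul_X (fun m => ?_) fun k =>
      ⟨sgn (g : SignedPerm n) k • polyMul M (X (perm (g : SignedPerm n) k)),
        diagAct ρ (K.w g) * diagAct ρ (κ i k), ?_, ?_⟩
    · simp [diagAct_w, IsDunkl.toEnd_tmul, (hD _).one]
    · rw [mul_assoc, IsDunkl.toEnd_mul_X, mul_add, ← mul_assoc, diagAct_w_mul_X, smul_mul_assoc,
        mul_assoc, smul_mul_assoc]
    · have h := congrArg (diagAct ρ) (hw g i k)
      rw [map_mul, map_smul, map_mul] at h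
      rw [h, smul_mul_assoc, mul_assoc, diagAct_w_mul_X, mul_smul_comm, ← mul_assoc,
        IsDunkl.toEnd_mul_X, add_mul, smul_add, mul_assoc, smul_add, smul_smul, smul_smul,
        smul_mul_assoc, mul_smul_comm, smul_smul,
        mul_comm (sgn (g : SignedPerm n) k) (sgn (g : SignedPerm n) i)]

/-- The commutator of `D_i D_j` with `x_k` is `D_i κ_{jk} + κ_{ik} D_j`, and the Jacobi identity
says precisely that this is symmetric in `i` and `j`. Both products kill `1 ⊗ M`. -/
theorem dunkl_comm (hD : ∀ i, IsDunkl ρ (κ i) (D i))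
    (hJ : JacobiHolds (fun i => (hD i).toEnd) fun j i => diagAct ρ (κ j i)) (i j : Fin n) :
    (hD i).toEnd * (hD j).toEnd = (hD j).toEnd * (hD i).toEnd := by
  have e (i j k : Fin n) : (hD i).toEnd * (hD j).toEnd * polyMul M (X k) =
      polyMul M (X k) * ((hD i).toEnd * (hD j).toEnd) + ((hD i).toEnd * diagAct ρ (κ j k) +
        diagAct ρ (κ i k) * (hD j).toEnd) := by
    rw [mul_assoc, IsDunkl.toEnd_mul_X, mul_add, ← mul_assoc, IsDunkl.toEnd_mul_X, add_mul,
      mul_assoc, add_assoc, add_comm (diagAct ρ (κ i k) * _)]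
  refine ext_of_mul_X (fun m => ?_) fun k => ⟨polyMul M (X k), _, e i j k, ?_⟩
  · simp [IsDunkl.toEnd_tmul, (hD _).one]
  · rw [e j i k, hJ.add_eq_add j i k]

end Dunkl

/-! ### The Hecke-Clifford algebra and its universal property -/

variable {comm : Fin n → Fin n → Free W}

/-- The words in the `c_i` and `W`, inside the free algebra on all generators. -/
def kWords (W : Subgroup (SignedPerm n)) : FreeAlgebra ℂ (KGen W) →ₐ[ℂ] Free W :=
  FreeAlgebra.lift ℂ fun | .c i => Free.c i | .w g => Free.w g

theorem kWords_c (i : Fin n) : kWords W (FreeAlgebra.ι ℂ (.c i)) = Free.c i :=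
  FreeAlgebra.lift_ι_apply _ _

theorem kWords_w (g : W) : kWords W (FreeAlgebra.ι ℂ (.w g)) = Free.w g :=
  FreeAlgebra.lift_ι_apply _ _

/-- `κ j i ∈ K` is the class of `comm j i`. -/
def IsCommValue (comm : Fin n → Fin n → Free W) (κ : Fin n → Fin n → K W) : Prop :=
  ∀ j i, ∃ p, kWords W p = comm j i ∧ K.mk W p = κ j i

/-- The prescribed bracket is a word in a free algebra, while the computations take place in `K`.
Both come from one word in the `c_i` and `W`, on which the two homomorphisms agree. -/
theorem IsCommValue.map_eq {κ : Fin n → Fin n → K W} (h : IsCommValue comm κ) {A : Type*} [Ring A]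
    [Algebra ℂ A] (F : Free W →ₐ[ℂ] A) (φ : K W →ₐ[ℂ] A)
    (hc : ∀ i, F (Free.c i) = φ (K.c i)) (hw : ∀ g, F (Free.w g) = φ (K.w g)) (j i : Fin n) :
    F (comm j i) = φ (κ j i) := by
  obtain ⟨p, hp, hp'⟩ := h j i
  have : F.comp (kWords W) = φ.comp (K.mk W) := by
    ext a
    cases a with
    | c i => simpa [kWords_c, K.mk_c] using hc i
    | w g => simpa [kWords_w, K.mk_w] using hw g
  rw [← hp, ← hp']
  exact DFunLike.congr_fun this p

namespace H

/-- The projection from the free algebra. -/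
def mk (W : Subgroup (SignedPerm n)) (comm : Fin n → Fin n → Free W) : Free W →ₐ[ℂ] H W comm :=
  RingQuot.mkAlgHom ℂ (Rel W comm)

theorem mk_rel {a b : Free W} (h : Rel W comm a b) : mk W comm a = mk W comm b :=
  RingQuot.mkAlgHom_rel ℂ h

theorem mk_x (i : Fin n) : mk W comm (Free.x i) = x i := rfl

theorem mk_c (i : Fin n) : mk W comm (Free.c i) = c i := rfl

theorem mk_w (g : W) : mk W comm (Free.w g) = w g := rfl

theorem x_mul_x (i j : Fin n) : (x i : H W comm) * x j = x j * x i := by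
  simpa [mk_x] using mk_rel (Rel.x_comm (comm := comm) i j)

theorem w_mul_w_inv_cancel (g : W) : (w g⁻¹ : H W comm) * w g = 1 := by
  have h₁ := mk_rel (Rel.w_mul (comm := comm) g⁻¹ g)
  have h₂ := mk_rel (Rel.w_one (comm := comm))
  rw [inv_mul_cancel] at h₁
  simpa [mk_w] using h₁.trans h₂

theorem w_mul_c (g : W) (i : Fin n) : (w g : H W comm) * c i =
    sgn (g : SignedPerm n) i • (c (perm (g : SignedPerm n) i) * w g) := by
  have : (w g : H W comm) * c i * w g⁻¹ =
      sgn (g : SignedPerm n) i • c (perm (g : SignedPerm n) i) := by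
    simpa [mk_w, mk_c] using mk_rel (Rel.w_c (comm := comm) g i)
  rw [← smul_mul_assoc, ← this, mul_assoc, w_mul_w_inv_cancel, mul_one]

theorem w_mul_x (g : W) (i : Fin n) : (w g : H W comm) * x i =
    sgn (g : SignedPerm n) i • (x (perm (g : SignedPerm n) i) * w g) := by
  have : (w g : H W comm) * x i * w g⁻¹ =
      sgn (g : SignedPerm n) i • x (perm (g : SignedPerm n) i) := by
    simpa [mk_w, mk_x] using mk_rel (Rel.w_x (comm := comm) g i)
  rw [← smul_mul_assoc, ← this, mul_assoc, w_mul_w_inv_cancel, mul_one]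

theorem c_mul_x (i j : Fin n) : (c i : H W comm) * x j = cSign i j • (x j * c i) := by
  rcases eq_or_ne i j with rfl | h
  · have : (x i : H W comm) * c i = -(c i * x i) := by
      simpa [mk_x, mk_c] using mk_rel (Rel.x_c_self (comm := comm) i)
    simp [cSign, this]
  · have : (x j : H W comm) * c i = c i * x j := by
      simpa [mk_x, mk_c] using mk_rel (Rel.x_c (comm := comm) j i h.symm)
    simp [cSign, h, this]

/-- The homomorphism `K → H`. -/
def ofK (W : Subgroup (SignedPerm n)) (comm : Fin n → Fin n → Free W) : K W →ₐ[ℂ] H W comm :=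
  K.lift c w
    (fun i => by simpa [mk_c] using mk_rel (Rel.c_sq (comm := comm) i))
    (fun i j h => by simpa [mk_c] using mk_rel (Rel.c_anti (comm := comm) i j h))
    (by simpa [mk_w] using mk_rel (Rel.w_one (comm := comm)))
    (fun g h => by simpa [mk_w] using mk_rel (Rel.w_mul (comm := comm) g h))
    w_mul_c

theorem ofK_c (i : Fin n) : ofK W comm (K.c i) = c i := K.lift_c ..

theorem ofK_w (g : W) : ofK W comm (K.w g) = w g := K.lift_w ..

theorem y_mul_x {κ : Fin n → Fin n → K W} (h : IsCommValue comm κ) (j i : Fin n) :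
    (y j : H W comm) * x i = x i * y j + ofK W comm (κ j i) := by
  have h₁ := mk_rel (Rel.y_x (comm := comm) j i)
  rw [h.map_eq (mk W comm) (ofK W comm) (fun i => (ofK_c i).symm) (fun g => (ofK_w g).symm),
    map_sub, map_mul, map_mul, sub_eq_iff_eq_add'] at h₁
  exact h₁

/-- A family `X`, `Y` of elements of an algebra over `K` that satisfies the relations of `H`. -/
structure IsRep {A : Type*} [Ring A] [Algebra ℂ A] (κ : Fin n → Fin n → K W) (φ : K W →ₐ[ℂ] A)
    (X Y : Fin n → A) : Prop where
  x_comm : ∀ i j, X i * X j = X j * X i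
  y_comm : ∀ i j, Y i * Y j = Y j * Y i
  c_x : ∀ i j, φ (K.c i) * X j = cSign i j • (X j * φ (K.c i))
  w_x : ∀ (g : W) i, φ (K.w g) * X i =
    sgn (g : SignedPerm n) i • (X (perm (g : SignedPerm n) i) * φ (K.w g))
  kVector : IsKVector φ Y
  y_x : ∀ j i, Y j * X i = X i * Y j + φ (κ j i)

section lift

variable {A : Type*} [Ring A] [Algebra ℂ A] {κ : Fin n → Fin n → K W} {φ : K W →ₐ[ℂ] A}
  {X Y : Fin n → A}

/-- The assignment of the generators on the free algebra. -/
def freeLift (φ : K W →ₐ[ℂ] A) (X Y : Fin n → A) : Free W →ₐ[ℂ] A :=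
  FreeAlgebra.lift ℂ fun
    | .x i => X i
    | .y i => Y i
    | .c i => φ (K.c i)
    | .w g => φ (K.w g)

theorem freeLift_x (i : Fin n) : freeLift φ X Y (Free.x i) = X i := FreeAlgebra.lift_ι_apply _ _

theorem freeLift_y (i : Fin n) : freeLift φ X Y (Free.y i) = Y i := FreeAlgebra.lift_ι_apply _ _

theorem freeLift_c (i : Fin n) : freeLift φ X Y (Free.c i) = φ (K.c i) :=
  FreeAlgebra.lift_ι_apply _ _

theorem freeLift_w (g : W) : freeLift φ X Y (Free.w g) = φ (K.w g) := FreeAlgebra.lift_ι_apply _ _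

theorem freeLift_rel (hκ : IsCommValue comm κ) (h : IsRep κ φ X Y) {a b : Free W}
    (hab : Rel W comm a b) : freeLift φ X Y a = freeLift φ X Y b := by
  have hinv (g : W) : φ (K.w g) * φ (K.w g⁻¹) = 1 := by rw [← map_mul, K.w_mul_inv, map_one]
  cases hab with
  | c_sq i => rw [map_mul, freeLift_c, ← map_mul, K.c_mul_self, map_one, map_one]
  | c_anti i j hij =>
    rw [map_neg, map_mul, map_mul, freeLift_c, freeLift_c, ← map_mul, ← map_mul, K.c_mul_c hij,
      map_neg]
  | x_comm i j => rw [map_mul, map_mul, freeLift_x, freeLift_x, h.x_comm]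
  | y_comm i j => rw [map_mul, map_mul, freeLift_y, freeLift_y, h.y_comm]
  | y_c i j => rw [map_mul, map_mul, freeLift_y, freeLift_c, h.kVector.c]
  | x_c_self i =>
    rw [map_neg, map_mul, map_mul, freeLift_x, freeLift_c, h.c_x]
    simp [cSign]
  | x_c i j hij =>
    rw [map_mul, map_mul, freeLift_x, freeLift_c, h.c_x]
    simp [cSign, hij.symm]
  | w_one => rw [freeLift_w, K.w_one, map_one, map_one]
  | w_mul g g' => rw [map_mul, freeLift_w, freeLift_w, freeLift_w, ← map_mul, K.w_mul]
  | w_x g i =>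
    rw [map_mul, map_mul, map_smul, freeLift_w, freeLift_w, freeLift_x, freeLift_x, h.w_x,
      smul_mul_assoc, mul_assoc, hinv, mul_one]
  | w_y g i =>
    rw [map_mul, map_mul, map_smul, freeLift_w, freeLift_w, freeLift_y, freeLift_y, h.kVector.w,
      smul_mul_assoc, mul_assoc, hinv, mul_one]
  | w_c g i =>
    rw [map_mul, map_mul, map_smul, freeLift_w, freeLift_w, freeLift_c, freeLift_c, ← map_mul,
      K.w_mul_c, map_smul, map_mul, smul_mul_assoc, mul_assoc, hinv, mul_one]
  | y_x j i =>
    rw [hκ.map_eq (freeLift φ X Y) φ freeLift_c freeLift_w, map_sub, map_mul, map_mul, freeLift_x,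
      freeLift_y, h.y_x, add_sub_cancel_left]

/-- The homomorphism `H → A` given by elements that satisfy the relations. -/
def lift (hκ : IsCommValue comm κ) (h : IsRep κ φ X Y) : H W comm →ₐ[ℂ] A :=
  RingQuot.liftAlgHom ℂ ⟨freeLift φ X Y, fun _ _ hab => freeLift_rel hκ h hab⟩

theorem lift_mk (hκ : IsCommValue comm κ) (h : IsRep κ φ X Y) (a : Free W) :
    lift hκ h (mk W comm a) = freeLift φ X Y a :=
  RingQuot.liftAlgHom_mkAlgHom_apply ℂ _ _ _

end lift

/-- Induction over the elements of `H`. -/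
theorem induction {p : H W comm → Prop} (hx : ∀ i, p (x i)) (hy : ∀ i, p (y i))
    (hc : ∀ i, p (c i)) (hw : ∀ g, p (w g)) (hr : ∀ r : ℂ, p (algebraMap ℂ _ r))
    (hadd : ∀ a b, p a → p b → p (a + b)) (hmul : ∀ a b, p a → p b → p (a * b))
    (a : H W comm) : p a := by
  obtain ⟨a, rfl⟩ := RingQuot.mkAlgHom_surjective ℂ (Rel W comm) a
  change p (mk W comm a)
  induction a using FreeAlgebra.induction with
  | grade0 r => simpa using hr r
  | grade1 a =>
    cases a with
    | x i => exact hx i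
    | y i => exact hy i
    | c i => exact hc i
    | w g => exact hw g
  | mul a b ha hb => rw [map_mul]; exact hmul _ _ ha hb
  | add a b ha hb => rw [map_add]; exact hadd _ _ ha hb

end H

/-! ### Induced modules -/

section Induced

variable {A : Type*} [Ring A] [Algebra ℂ A] {M : Type*} [AddCommGroup M] [Module ℂ M]
  {S : Subalgebra ℂ A} {ρ : S →ₐ[ℂ] Module.End ℂ M}

theorem Ind.smul_tmul (a b : A) (m : M) : a • Ind.tmul S ρ b m = Ind.tmul S ρ (a * b) m := rfl

theorem Ind.tmul_smul (s : S) (m : M) :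
    Ind.tmul S ρ (s : A) m = Ind.tmul S ρ 1 (ρ s m) := by
  refine (Submodule.Quotient.eq _).mpr (Submodule.subset_span ⟨1, s, m, ?_⟩)
  rw [one_mul]

/-- `m ↦ 1 ⊗ m`. -/
def Ind.unit (S : Subalgebra ℂ A) (ρ : S →ₐ[ℂ] Module.End ℂ M) : M →ₗ[ℂ] Ind S ρ :=
  ((indRel S ρ).mkQ.restrictScalars ℂ).comp (TensorProduct.mk ℂ A M 1)

theorem Ind.unit_apply (m : M) : Ind.unit S ρ m = Ind.tmul S ρ 1 m := rfl

theorem Ind.hom_ext {V : Type*} [AddCommGroup V] [Module ℂ V] {F G : Ind S ρ →ₗ[ℂ] V}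
    (h : ∀ a m, F (Ind.tmul S ρ a m) = G (Ind.tmul S ρ a m)) : F = G := by
  refine LinearMap.ext fun t => ?_
  obtain ⟨t, rfl⟩ := Submodule.Quotient.mk_surjective _ t
  induction t using TensorProduct.induction_on with
  | zero => rw [Submodule.Quotient.mk_zero, map_zero, map_zero]
  | tmul a m => exact h a m
  | add s t hs ht => rw [Submodule.Quotient.mk_add, map_add, map_add, hs, ht]

/-- Frobenius reciprocity: an `S`-linear map from `M` to an `A`-module extends to `Ind M`. -/
theorem Ind.exists_extension {V : Type*} [AddCommGroup V] [Module ℂ V] (Φ : A →ₐ[ℂ] Module.End ℂ V)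
    (ι : M →ₗ[ℂ] V) (hι : ∀ (s : S) m, Φ s (ι m) = ι (ρ s m)) :
    ∃ F : Ind S ρ →ₗ[ℂ] V, ∀ a m, F (Ind.tmul S ρ a m) = Φ a (ι m) := by
  let F₀ : A ⊗[ℂ] M →ₗ[ℂ] V := TensorProduct.lift ((LinearMap.lcomp ℂ V ι).comp Φ.toLinearMap)
  have hF₀ (a : A) (m : M) : F₀ (a ⊗ₜ m) = Φ a (ι m) := rfl
  have hsmul (a : A) (t : A ⊗[ℂ] M) : F₀ (a • t) = Φ a (F₀ t) := by
    induction t using TensorProduct.induction_on with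
    | zero => rw [smul_zero, map_zero, map_zero]
    | tmul b m => rw [TensorProduct.smul_tmul', smul_eq_mul, hF₀, hF₀, map_mul]; rfl
    | add s t hs ht => rw [smul_add, map_add, map_add, map_add, hs, ht]
  have hker (t : A ⊗[ℂ] M) (ht : t ∈ indRel S ρ) : F₀ t = 0 := by
    induction ht using Submodule.span_induction with
    | mem t ht =>
      obtain ⟨a, s, m, rfl⟩ := ht
      rw [map_sub, hF₀, hF₀, map_mul, Module.End.mul_apply, hι, sub_self]
    | zero => exact map_zero _
    | add s t _ _ hs ht => rw [map_add, hs, ht, add_zero]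
    | smul a t _ ht => rw [hsmul, ht, map_zero]
  exact ⟨(Submodule.liftQ ((indRel S ρ).restrictScalars ℂ) F₀ hker).comp
    (Submodule.Quotient.restrictScalarsEquiv ℂ (indRel S ρ)).symm.toLinearMap, fun a m => rfl⟩

end Induced

open scoped IsMulCommutative in
/-- Evaluation of polynomials at pairwise commuting elements of an algebra. -/
theorem exists_aeval_of_commute {σ A : Type*} [Ring A] [Algebra ℂ A] (a : σ → A)
    (h : ∀ i j, a i * a j = a j * a i) :
    ∃ F : MvPolynomial σ ℂ →ₐ[ℂ] A, ∀ i, F (X i) = a i := by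
  -- Evaluation needs a commutative target, and the subalgebra generated by commuting elements is
  -- one.
  have := Algebra.isMulCommutative_adjoin ℂ (s := Set.range a) (by
    rintro _ ⟨i, rfl⟩ _ ⟨j, rfl⟩
    exact h i j)
  refine ⟨(Algebra.adjoin ℂ (Set.range a)).val.comp
    (aeval fun i => (⟨a i, Algebra.subset_adjoin ⟨i, rfl⟩⟩ : Algebra.adjoin ℂ (Set.range a))),
    fun i => ?_⟩
  rw [AlgHom.comp_apply, aeval_X]
  rfl

theorem mul_algHom_of_mul_X {σ A : Type*} [Ring A] [Algebra ℂ A] (F : MvPolynomial σ ℂ →ₐ[ℂ] A)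
    (ψ : MvPolynomial σ ℂ →ₐ[ℂ] MvPolynomial σ ℂ) (a : A)
    (h : ∀ i, a * F (X i) = F (ψ (X i)) * a) (f : MvPolynomial σ ℂ) :
    a * F f = F (ψ f) * a := by
  induction f using MvPolynomial.induction_on with
  | C r =>
    rw [← algebraMap_eq, AlgHom.commutes, AlgHom.commutes, AlgHom.commutes, Algebra.commutes]
  | add p q hp hq => rw [map_add, map_add, map_add, mul_add, hp, hq, add_mul]
  | mul_X p i hp => rw [map_mul, map_mul, map_mul, ← mul_assoc, hp, mul_assoc, h, mul_assoc]

/-! ### Realization of the induced module -/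

section Realization

variable {M : Type*} [AddCommGroup M] [Module ℂ M] {ρ : K W →ₐ[ℂ] Module.End ℂ M}
  {κ : Fin n → Fin n → K W}
  {D : Fin n → MvPolynomial (Fin n) ℂ → M → MvPolynomial (Fin n) ℂ ⊗[ℂ] M}

/-- The Jacobi identity may be assumed for every family `Y` that transforms correctly under `K`: its
proof uses nothing else, and `isKVector_dunkl` shows that the Dunkl operators form such a family. -/
theorem isRep_dunkl (hc : ∀ j i l, κ j i * K.c l = cSign l i • (K.c l * κ j i))
    (hw : IsEquivariant κ) (hD : ∀ i, IsDunkl ρ (κ i) (D i))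
    (hJ : ∀ Y, IsKVector (diagAct ρ) Y → JacobiHolds Y fun j i => diagAct ρ (κ j i)) :
    H.IsRep κ (diagAct ρ) (fun i => polyMul M (X i)) fun i => (hD i).toEnd where
  x_comm i j := by rw [← map_mul, ← map_mul, mul_comm]
  y_comm := dunkl_comm hD (hJ _ (isKVector_dunkl hc hw hD))
  c_x := diagAct_c_mul_X ρ
  w_x := diagAct_w_mul_X ρ
  kVector := isKVector_dunkl hc hw hD
  y_x j i := (hD j).toEnd_mul_X i

/-- The constructed representation does the work of a PBW theorem: it shows that the trivial
extension is consistent and that `f(x) ⊗ m` loses no information about `f ⊗ m`. -/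
theorem realizedBy_of_isRep (hκ : IsCommValue comm κ) (hD : ∀ i, IsDunkl ρ (κ i) (D i))
    (hrep : H.IsRep κ (diagAct ρ) (fun i => polyMul M (X i)) fun i => (hD i).toEnd) :
    RealizedBy comm ρ D := by
  let Φ : H W comm →ₐ[ℂ] Module.End ℂ (MvPolynomial (Fin n) ℂ ⊗[ℂ] M) := H.lift hκ hrep
  have hΦx (i : Fin n) : Φ (H.x i) = polyMul M (X i) := (H.lift_mk hκ hrep _).trans (H.freeLift_x i)
  have hΦy (i : Fin n) : Φ (H.y i) = (hD i).toEnd := (H.lift_mk hκ hrep _).trans (H.freeLift_y i)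
  have hΦc (i : Fin n) : Φ (H.c i) = diagAct ρ (K.c i) :=
    (H.lift_mk hκ hrep _).trans (H.freeLift_c i)
  have hΦw (g : W) : Φ (H.w g) = diagAct ρ (K.w g) := (H.lift_mk hκ hrep _).trans (H.freeLift_w g)
  let ι : M →ₗ[ℂ] MvPolynomial (Fin n) ℂ ⊗[ℂ] M := TensorProduct.mk ℂ _ M 1
  -- Evaluation of the polynomial factor at `0`, a left inverse of `ι`.
  let ε : MvPolynomial (Fin n) ℂ ⊗[ℂ] M →ₗ[ℂ] M :=
    (TensorProduct.lid ℂ M).toLinearMap.comp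
      (TensorProduct.map (aeval (0 : Fin n → ℂ)).toLinearMap LinearMap.id)
  have hει (m : M) : ε (ι m) = m := by simp [ε, ι]
  have hΦcι (i : Fin n) (m : M) : Φ (H.c i) (ι m) = ι (ρ (K.c i) m) := by
    simp [hΦc, ι, diagAct_c]
  have hΦwι (g : W) (m : M) : Φ (H.w g) (ι m) = ι (ρ (K.w g) m) := by
    simp [hΦw, ι, diagAct_w]
  have hΦyι (i : Fin n) (m : M) : Φ (H.y i) (ι m) = 0 := by
    simp [hΦy, ι, IsDunkl.toEnd_tmul, (hD i).one]
  -- The subalgebra preserves `1 ⊗ M`, since its generators do. Hence compressing its action by `ε`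
  -- and `ι` is multiplicative.
  have stable (a : H W comm) (ha : a ∈ H.subY W comm) :
      ∃ T : Module.End ℂ M, ∀ m, Φ a (ι m) = ι (T m) := by
    induction ha using Algebra.adjoin_induction with
    | mem a ha =>
      rcases ha with (⟨i, rfl⟩ | ⟨g, rfl⟩) | ⟨i, rfl⟩
      · exact ⟨ρ (K.c i), hΦcι i⟩
      · exact ⟨ρ (K.w g), hΦwι g⟩
      · exact ⟨0, fun m => by rw [hΦyι, LinearMap.zero_apply, map_zero]⟩
    | algebraMap r => exact ⟨r • 1, fun m => by simp [Algebra.algebraMap_eq_smul_one]⟩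
    | add a b _ _ ha hb =>
      obtain ⟨T, hT⟩ := ha
      obtain ⟨T', hT'⟩ := hb
      exact ⟨T + T', fun m => by
        rw [map_add, LinearMap.add_apply, hT, hT', LinearMap.add_apply, map_add]⟩
    | mul a b _ _ ha hb =>
      obtain ⟨T, hT⟩ := ha
      obtain ⟨T', hT'⟩ := hb
      exact ⟨T * T', fun m => by
        rw [map_mul, Module.End.mul_apply, hT', hT, Module.End.mul_apply]⟩
  have hsub (s : H.subY W comm) (m : M) : ι (ε (Φ s (ι m))) = Φ s (ι m) := by
    obtain ⟨T, hT⟩ := stable s s.2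
    rw [hT, hει]
  have exists_ext : ∃ ρy : H.subY W comm →ₐ[ℂ] Module.End ℂ M, IsTrivialExt ρ ρy := by
    refine ⟨AlgHom.ofLinearMap
      (((LinearMap.llcomp ℂ M _ M ε).comp (LinearMap.lcomp ℂ _ ι)).comp
        (Φ.toLinearMap.comp (H.subY W comm).val.toLinearMap)) ?_ ?_, ?_, ?_, ?_⟩
    · ext m
      change ε (Φ 1 (ι m)) = m
      rw [map_one, Module.End.one_apply, hει]
    · intro s t
      ext m
      change ε (Φ (s * t : H W comm) (ι m)) = ε (Φ s (ι (ε (Φ t (ι m)))))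
      rw [hsub, map_mul, Module.End.mul_apply]
    · intro i
      ext m
      change ε (Φ (H.c i) (ι m)) = _
      rw [hΦcι, hει]
    · intro g
      ext m
      change ε (Φ (H.w g) (ι m)) = _
      rw [hΦwι, hει]
    · intro i
      ext m
      change ε (Φ (H.y i) (ι m)) = _
      rw [hΦyι, map_zero, LinearMap.zero_apply]
  have unique_ext (ρy ρy' : H.subY W comm →ₐ[ℂ] Module.End ℂ M) (h : IsTrivialExt ρ ρy)
      (h' : IsTrivialExt ρ ρy') : ρy = ρy' := by
    refine AlgHom.adjoin_ext ?_
    rintro _ ((⟨i, rfl⟩ | ⟨g, rfl⟩) | ⟨i, rfl⟩)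
    · exact (h.c i).trans (h'.c i).symm
    · exact (h.w g).trans (h'.w g).symm
    · exact (h.y i).trans (h'.y i).symm
  refine ⟨?_, fun ρy hρy => ?_⟩
  · obtain ⟨ρy, h⟩ := exists_ext
    exact ⟨ρy, h, fun ρy' h' => unique_ext ρy' ρy h' h⟩
  -- Any trivial extension makes `ι` linear over the subalgebra, which is the hypothesis of
  -- Frobenius reciprocity.
  have hι (s : H.subY W comm) (m : M) : Φ s (ι m) = ι (ρy s m) := by
    obtain ⟨s, hs⟩ := s
    change Φ s (ι m) = _
    induction hs using Algebra.adjoin_induction generalizing m with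
    | mem a ha =>
      rcases ha with (⟨i, rfl⟩ | ⟨g, rfl⟩) | ⟨i, rfl⟩
      · exact (hΦcι i m).trans (by rw [← hρy.c i]; rfl)
      · exact (hΦwι g m).trans (by rw [← hρy.w g]; rfl)
      · refine (hΦyι i m).trans ?_
        have : ρy (H.subY.y i) m = 0 := by rw [hρy.y]; rfl
        exact (map_zero ι).symm.trans (congrArg ι this.symm)
    | algebraMap r =>
      have : ρy ⟨algebraMap ℂ (H W comm) r, algebraMap_mem _ r⟩ = algebraMap ℂ _ r :=
        ρy.commutes r
      rw [this, AlgHom.commutes]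
      simp [Algebra.algebraMap_eq_smul_one]
    | add a b ha hb iha ihb =>
      have : ρy ⟨a + b, add_mem ha hb⟩ = ρy ⟨a, ha⟩ + ρy ⟨b, hb⟩ := map_add ρy ⟨a, ha⟩ ⟨b, hb⟩
      rw [this, map_add, LinearMap.add_apply, iha, ihb, LinearMap.add_apply, map_add]
    | mul a b ha hb iha ihb =>
      have : ρy ⟨a * b, mul_mem ha hb⟩ = ρy ⟨a, ha⟩ * ρy ⟨b, hb⟩ := map_mul ρy ⟨a, ha⟩ ⟨b, hb⟩
      rw [this, map_mul, Module.End.mul_apply, ihb, iha, Module.End.mul_apply]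
  obtain ⟨F, hF⟩ := Ind.exists_extension (S := H.subY W comm) (ρ := ρy) Φ ι hι
  obtain ⟨P, hP⟩ := exists_aeval_of_commute (H.x : Fin n → H W comm) H.x_mul_x
  let E : MvPolynomial (Fin n) ℂ ⊗[ℂ] M →ₗ[ℂ] Ind (H.subY W comm) ρy :=
    TensorProduct.lift ((LinearMap.lcomp ℂ _ (Ind.unit (H.subY W comm) ρy)).comp
      ((Algebra.lsmul ℂ ℂ (Ind (H.subY W comm) ρy)).toLinearMap.comp P.toLinearMap))
  have hE (f : MvPolynomial (Fin n) ℂ) (m : M) :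
      E (f ⊗ₜ m) = P f • Ind.tmul (H.subY W comm) ρy 1 m := rfl
  have hEone (m : M) : E (ι m) = Ind.tmul (H.subY W comm) ρy 1 m := by
    change E (1 ⊗ₜ m) = _
    rw [hE, map_one, one_smul]
  have hcE (i : Fin n) (t : MvPolynomial (Fin n) ℂ ⊗[ℂ] M) :
      (H.c i : H W comm) • E t = E (diagAct ρ (K.c i) t) := by
    induction t using TensorProduct.induction_on with
    | zero => simp
    | add s t hs ht => rw [map_add, smul_add, hs, ht, map_add, map_add]
    | tmul f m =>
      have h₁ : (H.c i : H W comm) * P f = P (twist i f) * H.c i :=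
        mul_algHom_of_mul_X P (twist i) _ (fun j => by
          rw [twist_X, map_smul, hP, H.c_mul_x, smul_mul_assoc]) f
      have h₂ : (H.c i : H W comm) • Ind.tmul (H.subY W comm) ρy 1 m =
          Ind.tmul (H.subY W comm) ρy 1 (ρ (K.c i) m) := by
        rw [Ind.smul_tmul, mul_one, ← hρy.c]
        exact Ind.tmul_smul (H.subY.c i) m
      rw [hE, diagAct_c, hE, ← h₂, smul_smul, h₁, smul_smul]
  have hwE (g : W) (t : MvPolynomial (Fin n) ℂ ⊗[ℂ] M) :
      (H.w g : H W comm) • E t = E (diagAct ρ (K.w g) t) := by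
    induction t using TensorProduct.induction_on with
    | zero => simp
    | add s t hs ht => rw [map_add, smul_add, hs, ht, map_add, map_add]
    | tmul f m =>
      have h₁ : (H.w g : H W comm) * P f = P (polyAct g f) * H.w g :=
        mul_algHom_of_mul_X P (polyAct (g : SignedPerm n)) _ (fun j => by
          rw [polyAct_X, map_smul, hP, hP, H.w_mul_x, smul_mul_assoc]) f
      have h₂ : (H.w g : H W comm) • Ind.tmul (H.subY W comm) ρy 1 m =
          Ind.tmul (H.subY W comm) ρy 1 (ρ (K.w g) m) := by
        rw [Ind.smul_tmul, mul_one, ← hρy.w]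
        exact Ind.tmul_smul (H.subY.w g) m
      rw [hE, diagAct_w, hE, ← h₂, smul_smul, h₁, smul_smul]
  have hxE (i : Fin n) (t : MvPolynomial (Fin n) ℂ ⊗[ℂ] M) :
      (H.x i : H W comm) • E t = E (polyMul M (X i) t) := by
    induction t using TensorProduct.induction_on with
    | zero => simp
    | add s t hs ht => rw [map_add, smul_add, hs, ht, map_add, map_add]
    | tmul f m => rw [polyMul_tmul, hE, hE, map_mul, hP, mul_smul]
  have hkE (a : K W) (t : MvPolynomial (Fin n) ℂ ⊗[ℂ] M) :
      H.ofK W comm a • E t = E (diagAct ρ a t) := by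
    obtain ⟨a, rfl⟩ : ∃ b, K.mk W b = a := RingQuot.mkAlgHom_surjective ℂ (KRel W) a
    induction a using FreeAlgebra.induction generalizing t with
    | grade0 r => simp [Algebra.algebraMap_eq_smul_one]
    | grade1 a =>
      cases a with
      | c i => rw [K.mk_c, H.ofK_c, hcE]
      | w g => rw [K.mk_w, H.ofK_w, hwE]
    | mul a b ha hb =>
      rw [map_mul, map_mul, map_mul, mul_smul, hb, ha, Module.End.mul_apply]
    | add a b ha hb =>
      rw [map_add, map_add, map_add, add_smul, hb, ha, LinearMap.add_apply, map_add]
  have hyE (i : Fin n) (f : MvPolynomial (Fin n) ℂ) (m : M) :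
      (H.y i : H W comm) • E (f ⊗ₜ m) = E (D i f m) := by
    change _ = E ((hD i).toEnd (f ⊗ₜ m))
    induction f using MvPolynomial.induction_on with
    | C r =>
      have : (C r : MvPolynomial (Fin n) ℂ) = r • 1 := by rw [smul_eq_C_mul, mul_one]
      -- In the induced module `y_i` moves across the tensor sign and acts on `M` by zero.
      have h : (H.y i : H W comm) • E (1 ⊗ₜ m) = 0 := by
        rw [hE, map_one, one_smul, Ind.smul_tmul, mul_one]
        refine (Ind.tmul_smul (H.subY.y i) m).trans ?_
        rw [hρy.y, LinearMap.zero_apply, ← Ind.unit_apply, map_zero]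
      rw [this, ← TensorProduct.smul_tmul', map_smul, map_smul, map_smul, IsDunkl.toEnd_tmul,
        (hD i).one, map_zero, smul_comm, h]
    | add p q hp hq => rw [TensorProduct.add_tmul, map_add, smul_add, hp, hq, map_add, map_add]
    | mul_X p k hp =>
      -- Both actions of `y_i` pass `x_k` at the cost of the same element `κ i k` of `K`, which `E`
      -- already intertwines.
      rw [mul_comm, ← polyMul_tmul, ← hxE, smul_smul, H.y_mul_x hκ, add_smul, mul_smul, hp, hxE,
        hkE, ← map_add, ← Module.End.mul_apply, ← Module.End.mul_apply, ← LinearMap.add_apply,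
        IsDunkl.toEnd_mul_X]
  have hyE' (i : Fin n) (t : MvPolynomial (Fin n) ℂ ⊗[ℂ] M) :
      (H.y i : H W comm) • E t = E ((hD i).toEnd t) := by
    induction t using TensorProduct.induction_on with
    | zero => simp
    | add s t hs ht => rw [map_add, smul_add, hs, ht, map_add, map_add]
    | tmul f m => exact hyE i f m
  have hΦE (a : H W comm) (t : MvPolynomial (Fin n) ℂ ⊗[ℂ] M) : a • E t = E (Φ a t) := by
    induction a using H.induction generalizing t with
    | hx i => rw [hΦx, hxE]
    | hy i => rw [hΦy, hyE']
    | hc i => rw [hΦc, hcE]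
    | hw g => rw [hΦw, hwE]
    | hr r => simp [Algebra.algebraMap_eq_smul_one]
    | hadd a b ha hb => rw [add_smul, ha, hb, map_add, LinearMap.add_apply, map_add]
    | hmul a b ha hb => rw [mul_smul, hb, ha, map_mul, Module.End.mul_apply]
  -- By linearity of `E` over the algebra, it is enough that `E ∘ F` fixes `1 ⊗ m`.
  have hEF : E.comp F = LinearMap.id := Ind.hom_ext fun a m => by
    rw [LinearMap.comp_apply, hF, ← hΦE, hEone, Ind.smul_tmul, mul_one, LinearMap.id_apply]
  have hΦP : Φ.comp P = polyMul M := algHom_ext fun j => by rw [AlgHom.comp_apply, hP, hΦx]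
  have hFE : F.comp E = LinearMap.id := TensorProduct.ext' fun f m => by
    rw [LinearMap.comp_apply, hE, Ind.smul_tmul, mul_one, hF, ← AlgHom.comp_apply, hΦP]
    change polyMul M f (1 ⊗ₜ m) = _
    rw [polyMul_tmul, mul_one, LinearMap.id_apply]
  refine ⟨LinearEquiv.ofLinearMap E F hEF hFE, ⟨hEone, fun i f m => hxE i _⟩, fun g f m => ?_,
    fun i f m => ?_, hyE⟩
  · rw [← diagAct_w]; exact hwE g _
  · rw [← diagAct_c]; exact hcE i _

end Realization

/-! ### Dunkl operators of the reflection families -/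

theorem divS_spec (i k : Fin n) (f : MvPolynomial (Fin n) ℂ) :
    f - polyAct (s k i) f = (X i - X k) * divS i k f := (dvd_s i k f).choose_spec

theorem divSBar_spec (i k : Fin n) (f : MvPolynomial (Fin n) ℂ) :
    f - polyAct (sBar k i) f = (X i + X k) * divSBar i k f := (dvd_sBar i k f).choose_spec

theorem divTwist_spec (i k : Fin n) (f : MvPolynomial (Fin n) ℂ) :
    f - twist k (twist i (polyAct (s k i) f)) = (X i + X k) * divTwist i k f :=
  (dvd_twist i k f).choose_spec

theorem divTau_spec (i : Fin n) (f : MvPolynomial (Fin n) ℂ) :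
    f - polyAct (tau i) f = (2 * X i) * divTau i f := (dvd_tau i f).choose_spec

theorem polyAct_sBar (k i : Fin n) (f : MvPolynomial (Fin n) ℂ) :
    polyAct (sBar k i) f = twist k (twist i (polyAct (s k i) f)) := by
  rw [sBar, polyAct_mul, polyAct_mul, polyAct_tau, polyAct_tau]

/-- The sign changes made by `c_k c_i` undo those in `s̄`, so `c_k c_i s̄` acts on polynomials as
`s`. This is why the second quotient for `s̄` is the one with denominator `x_i - x_k`. -/
theorem twist_twist_polyAct_sBar (k i : Fin n) (f : MvPolynomial (Fin n) ℂ) :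
    twist k (twist i (polyAct (sBar k i) f)) = polyAct (s k i) f := by
  rw [polyAct_sBar, twist_comm i k, twist_twist_self, twist_twist_self]

theorem X_add_smul_X_ne_zero {i k : Fin n} (h : k ≠ i) (a : ℂ) :
    (X i + a • X k : MvPolynomial (Fin n) ℂ) ≠ 0 := by
  intro h₀
  -- At the point `e_i` the linear form takes the value `1`, because `k ≠ i`.
  have := congrArg (aeval (Pi.single i 1 : Fin n → ℂ)) h₀
  simp [h] at this

section Module

variable {V : Type*} [AddCommGroup V] [Module ℂ V]

theorem add_neg_one_smul (a b : V) : a + (-1 : ℂ) • b = a - b := by module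

theorem smul_neg_add_neg (u : ℂ) (a b : V) : u • (-a + -b) = -(u • a) - u • b := by module

theorem smul_neg_add_neg_add_neg_smul (u c : ℂ) (a b d : V) :
    u • (-a + -b) + (-c) • d = -(u • a) - u • b - c • d := by module

end Module

variable {M : Type*} [AddCommGroup M] [Module ℂ M] {ρ : K W →ₐ[ℂ] Module.End ℂ M}

theorem IsDunkl.congr {κ κ' : Fin n → K W}
    {T T' : MvPolynomial (Fin n) ℂ → M → MvPolynomial (Fin n) ℂ ⊗[ℂ] M} (h : IsDunkl ρ κ T)
    (hκ : ∀ l, κ l = κ' l) (hT : ∀ f m, T f m = T' f m) : IsDunkl ρ κ' T' := by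
  rwa [← funext hκ, ← funext fun f => funext (hT f)]

/-- The Dunkl operators of a family of reflections: `δ i k` and `δ' i k` are the divided
differences for `r_{ki}` and `c_k c_i r_{ki}`. -/
theorem isDunkl_reflBracket {ε : ℂ} {r : Fin n → Fin n → W} (hr : IsReflFamily ε r)
    (hsymm : ∀ k i, r k i = r i k)
    {δ δ' : Fin n → Fin n → MvPolynomial (Fin n) ℂ → MvPolynomial (Fin n) ℂ}
    (hδ : ∀ i k f, f - polyAct (r k i : SignedPerm n) f = (X i + (-ε) • X k) * δ i k f)
    (hδ' : ∀ i k f, f - twist k (twist i (polyAct (r k i : SignedPerm n) f)) =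
      (X i + ε • X k) * δ' i k f) (i : Fin n) :
    IsDunkl ρ (reflBracket ε K.c (fun k i => K.w (r k i)) i) fun f m =>
      -∑ k with k ≠ i, (δ i k f ⊗ₜ ρ (K.w (r k i)) m +
        ε • (δ' i k f ⊗ₜ ρ (K.c k * K.c i * K.w (r k i)) m)) := by
  have key (k : Fin n) (hk : k ∈ Finset.univ.filter (· ≠ i)) := by
    have hki : k ≠ i := (Finset.mem_filter.mp hk).2
    -- The coefficients come from `φ(x_i) = ε x_k` and `φ(x_k) = ε x_i`: with `q = x_i - ε x_k`, the
    -- difference `x_l - φ(x_l)` is `q` for `l = i` and `-ε q` for `l = k`.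
    have h₁ : IsDunkl ρ (fun l => (if l = i then 1 else if l = k then -ε else 0 : ℂ) •
        K.w (r k i)) fun f m => δ i k f ⊗ₜ ρ (K.w (r k i)) m := by
      refine .dividedDifference (X_add_smul_X_ne_zero hki _) _ (hδ i k) (diagAct_w ρ _)
        fun l => ?_
      rw [polyAct_X, hr.perm, hr.sgn k i hki]
      rcases eq_or_ne l i with rfl | hi
      · simp [sub_eq_add_neg]
      rcases eq_or_ne l k with rfl | hk
      · simp [hi, smul_add, smul_smul, hr.mul_self]
        abel
      · simp [hi, hk, Equiv.swap_apply_of_ne_of_ne]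
    -- Here `c_k c_i` reverses both signs, so `ε` is replaced by `-ε` in `q` and in the
    -- coefficients.
    have h₂ : IsDunkl ρ (fun l => (if l = i then 1 else if l = k then ε else 0 : ℂ) •
        (K.c k * K.c i * K.w (r k i)))
        fun f m => δ' i k f ⊗ₜ ρ (K.c k * K.c i * K.w (r k i)) m := by
      refine .dividedDifference (X_add_smul_X_ne_zero hki _)
        ((twist k).comp ((twist i).comp (polyAct (r k i : SignedPerm n)))) (hδ' i k)
        (fun f m => ?_) fun l => ?_
      · rw [map_mul, map_mul, Module.End.mul_apply, Module.End.mul_apply, diagAct_w, diagAct_c,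
          diagAct_c, map_mul, map_mul]
        rfl
      · rw [AlgHom.comp_apply, AlgHom.comp_apply, polyAct_X, hr.perm, hr.sgn k i hki]
        rcases eq_or_ne l i with rfl | hi
        · simp [twist_X, cSign, hki.symm]
        rcases eq_or_ne l k with rfl | hk
        · simp [twist_X, cSign, hi, smul_add, smul_smul, hr.mul_self, add_comm]
        · simp [twist_X, cSign, hi, hk, hi.symm, hk.symm, Equiv.swap_apply_of_ne_of_ne]
    exact h₁.add (h₂.smul ε)
  refine ((IsDunkl.sum _ key).smul (-1)).congr (fun l => ?_) fun f m =>
    neg_one_smul ℂ (M := MvPolynomial (Fin n) ℂ ⊗[ℂ] M) _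
  rw [neg_one_smul]
  symm
  rcases eq_or_ne i l with rfl | hil
  · simp [reflBracket, reflTerm, add_mul]
  · rw [Finset.sum_eq_single_of_mem l (by simp [hil.symm])]
    · simp [reflBracket, reflTerm, hil, hil.symm, add_mul, smul_smul, hr.mul_self, hsymm l i,
        K.c_mul_c hil, add_comm]
    · intro k _ hk
      simp [hk.symm, hil.symm]

theorem isDunkl_diagBracket {t : Fin n → W} (ht : ∀ i, (t i : SignedPerm n) = tau i) (i : Fin n) :
    IsDunkl ρ (diagBracket (fun i => K.w (t i)) i) fun f m => divTau i f ⊗ₜ ρ (K.w (t i)) m := by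
  have h : IsDunkl ρ (fun l => (if l = i then 1 else 0 : ℂ) • K.w (t i))
      fun f m => divTau i f ⊗ₜ ρ (K.w (t i)) m := by
    refine .dividedDifference (mul_ne_zero two_ne_zero (X_ne_zero i)) _ (divTau_spec i)
      (fun f m => by rw [diagAct_w, ht]) fun l => ?_
    rw [polyAct_tau_X]
    split_ifs with h
    · rw [h, one_smul]; ring
    · simp
  convert h using 1
  funext l
  rcases eq_or_ne i l with rfl | hil
  · simp [diagBracket]
  · simp [diagBracket, hil, hil.symm]

/-- The second quotient is left free because type A writes it as `divTwist` and types B and D as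
`divSBar`; by `polyAct_sBar` both divide the same polynomial by `x_i + x_k`. -/
theorem isDunkl_s {r : Fin n → Fin n → W} (hr : ∀ k i, (r k i : SignedPerm n) = s k i)
    {δ' : Fin n → Fin n → MvPolynomial (Fin n) ℂ → MvPolynomial (Fin n) ℂ}
    (hδ' : ∀ i k f, f - twist k (twist i (polyAct (s k i) f)) = (X i + X k) * δ' i k f)
    (i : Fin n) :
    IsDunkl ρ (reflBracket 1 K.c (fun k i => K.w (r k i)) i) fun f m =>
      -∑ k with k ≠ i, (divS i k f ⊗ₜ ρ (K.w (r k i)) m +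
        δ' i k f ⊗ₜ ρ (K.c k * K.c i * K.w (r k i)) m) := by
  have h := isDunkl_reflBracket (ρ := ρ) (.s hr)
    (fun k i => Subtype.ext (by rw [hr, hr, s_comm])) (δ := divS) (δ' := δ')
    (fun i k f => by rw [hr, divS_spec, neg_smul, one_smul, sub_eq_add_neg])
    (fun i k f => by rw [hr, hδ', one_smul]) i
  simpa only [one_smul] using h

theorem isDunkl_sBar {r : Fin n → Fin n → W} (hr : ∀ k i, (r k i : SignedPerm n) = sBar k i)
    (i : Fin n) :
    IsDunkl ρ (reflBracket (-1) K.c (fun k i => K.w (r k i)) i) fun f m =>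
      -∑ k with k ≠ i, (divSBar i k f ⊗ₜ ρ (K.w (r k i)) m -
        divS i k f ⊗ₜ ρ (K.c k * K.c i * K.w (r k i)) m) := by
  have h := isDunkl_reflBracket (ρ := ρ) (.sBar hr)
    (fun k i => Subtype.ext (by rw [hr, hr, sBar_comm])) (δ := divSBar) (δ' := divS)
    (fun i k f => by rw [hr, divSBar_spec, neg_neg, one_smul])
    (fun i k f => by
      rw [hr, twist_twist_polyAct_sBar, divS_spec, neg_smul, one_smul, sub_eq_add_neg]) i
  exact h.congr (fun _ => rfl) fun f m => congrArg Neg.neg (Finset.sum_congr rfl fun k _ =>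
    add_neg_one_smul (V := MvPolynomial (Fin n) ℂ ⊗[ℂ] M) _ _)

/-! ### Values of the brackets -/

section CommValue

variable {comm comm' : Fin n → Fin n → Free W} {κ κ' : Fin n → Fin n → K W}

theorem IsCommValue.add (h : IsCommValue comm κ) (h' : IsCommValue comm' κ') :
    IsCommValue (fun j i => comm j i + comm' j i) fun j i => κ j i + κ' j i := fun j i => by
  obtain ⟨p, hp, hp'⟩ := h j i
  obtain ⟨q, hq, hq'⟩ := h' j i
  exact ⟨p + q, by rw [map_add, hp, hq], by rw [map_add, hp', hq']⟩

theorem IsCommValue.smul (h : IsCommValue comm κ) (a : ℂ) :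
    IsCommValue (fun j i => a • comm j i) fun j i => a • κ j i := fun j i => by
  obtain ⟨p, hp, hp'⟩ := h j i
  exact ⟨a • p, by rw [map_smul, hp], by rw [map_smul, hp']⟩

theorem isCommValue_reflBracket (ε : ℂ) (r : Fin n → Fin n → W) :
    IsCommValue (reflBracket ε Free.c fun k i => Free.w (r k i))
      (reflBracket ε K.c fun k i => K.w (r k i)) := fun j i =>
  ⟨reflBracket ε (fun i => FreeAlgebra.ι ℂ (.c i)) (fun k i => FreeAlgebra.ι ℂ (.w (r k i))) j i,
    by simp only [map_reflBracket, kWords_c, kWords_w],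
    by simp only [map_reflBracket, K.mk_c, K.mk_w]⟩

theorem isCommValue_diagBracket (t : Fin n → W) :
    IsCommValue (diagBracket fun i => Free.w (t i)) (diagBracket fun i => K.w (t i)) := fun j i =>
  ⟨diagBracket (fun i => FreeAlgebra.ι ℂ (.w (t i))) j i,
    by simp only [map_diagBracket, kWords_w], by simp only [map_diagBracket, K.mk_w]⟩

end CommValue

/-! ### The three types -/

theorem commA_eq (u : ℂ) : commA n u =
    fun j i => u • reflBracket 1 Free.c (fun k i => Free.w (sA k i)) j i := by
  funext j i
  unfold commA reflBracket
  split_ifs <;> simp [reflTerm]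

theorem sD_comm (i j : Fin n) : sD i j = sD j i := Subtype.ext (s_comm i j)

theorem sBarD_comm (i j : Fin n) : sBarD i j = sBarD j i := Subtype.ext (sBar_comm i j)

theorem sB_comm (i j : Fin n) : sB i j = sB j i := Subtype.ext (s_comm i j)

theorem sBarB_comm (i j : Fin n) : sBarB i j = sBarB j i := Subtype.ext (sBar_comm i j)

theorem commD_eq (u : ℂ) : commD n u = fun j i =>
    u • (reflBracket 1 Free.c (fun k i => Free.w (sD k i)) j i +
      reflBracket (-1) Free.c (fun k i => Free.w (sBarD k i)) j i) := by
  funext j i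
  unfold commD reflBracket
  split_ifs
  · simp only [reflTerm, one_smul, neg_smul, ← sub_eq_add_neg, Finset.sum_add_distrib]
    module
  · simp only [reflTerm, one_smul, neg_smul, ← sub_eq_add_neg, sD_comm i j, sBarD_comm i j]

theorem commB_eq (u v : ℂ) : commB n u v = fun j i =>
    u • (reflBracket 1 Free.c (fun k i => Free.w (sB k i)) j i +
      reflBracket (-1) Free.c (fun k i => Free.w (sBarB k i)) j i) +
      (-(((√2 : ℝ) : ℂ) * v)) • diagBracket (fun i => Free.w (tauB i)) j i := by
  funext j i
  unfold commB reflBracket diagBracket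
  split_ifs
  · simp only [reflTerm, one_smul, neg_smul, ← sub_eq_add_neg, Finset.sum_add_distrib]
    module
  · simp only [reflTerm, one_smul, neg_smul, ← sub_eq_add_neg, sB_comm i j, sBarB_comm i j,
      smul_zero, add_zero]

theorem realizedBy_typeA (u : ℂ) (ρ : K (weylA n) →ₐ[ℂ] Module.End ℂ M) :
    RealizedBy (commA n u) ρ fun i f m => -(u • ∑ k with k ≠ i,
      (divS i k f ⊗ₜ[ℂ] ρ (K.w (sA k i)) m +
        divTwist i k f ⊗ₜ[ℂ] ρ (K.c k * K.c i * K.w (sA k i)) m)) := by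
  have hr : IsReflFamily 1 (sA (n := n)) := .s fun _ _ => rfl
  have hD := fun i => (isDunkl_s (ρ := ρ) (r := sA) (fun _ _ => rfl) divTwist_spec i).smul u
  simp only [smul_neg] at hD
  rw [commA_eq]
  refine realizedBy_of_isRep ((isCommValue_reflBracket 1 sA).smul u) hD (isRep_dunkl ?_ ?_ hD ?_)
  · intro j i l
    rw [smul_mul_assoc, reflBracket_mul_c hr, mul_smul_comm, smul_comm]
  · exact (isEquivariant_reflBracket_s (r := sA) (fun _ _ => rfl) sgn_weylA).smul u
  · intro Y hY
    simpa only [map_smul] using (hY.jacobi_reflBracket hr).smul u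

theorem realizedBy_typeD (u : ℂ) (ρ : K (weylD n) →ₐ[ℂ] Module.End ℂ M) :
    RealizedBy (commD n u) ρ fun i f m =>
      -(u • ∑ k with k ≠ i, (divS i k f ⊗ₜ[ℂ] ρ (K.w (sD k i)) m +
        divSBar i k f ⊗ₜ[ℂ] ρ (K.c k * K.c i * K.w (sD k i)) m)) -
      u • ∑ k with k ≠ i, (divSBar i k f ⊗ₜ[ℂ] ρ (K.w (sBarD k i)) m -
        divS i k f ⊗ₜ[ℂ] ρ (K.c k * K.c i * K.w (sBarD k i)) m) := by
  have hr : IsReflFamily 1 (sD (n := n)) := .s fun _ _ => rfl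
  have hr' : IsReflFamily (-1) (sBarD (n := n)) := .sBar fun _ _ => rfl
  have hD (i : Fin n) : IsDunkl ρ (fun l => u • (reflBracket 1 K.c (fun k i => K.w (sD k i)) i l +
      reflBracket (-1) K.c (fun k i => K.w (sBarD k i)) i l)) fun f m =>
      -(u • ∑ k with k ≠ i, (divS i k f ⊗ₜ[ℂ] ρ (K.w (sD k i)) m +
        divSBar i k f ⊗ₜ[ℂ] ρ (K.c k * K.c i * K.w (sD k i)) m)) -
      u • ∑ k with k ≠ i, (divSBar i k f ⊗ₜ[ℂ] ρ (K.w (sBarD k i)) m -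
        divS i k f ⊗ₜ[ℂ] ρ (K.c k * K.c i * K.w (sBarD k i)) m) := by
    have h := ((isDunkl_s (ρ := ρ) (r := sD) (fun _ _ => rfl)
      (fun i k f => by rw [← polyAct_sBar, divSBar_spec]) i).add
        (isDunkl_sBar (r := sBarD) (fun _ _ => rfl) i)).smul u
    exact h.congr (fun _ => rfl) fun f m => smul_neg_add_neg u _ _
  rw [commD_eq]
  refine realizedBy_of_isRep
    (((isCommValue_reflBracket 1 sD).add (isCommValue_reflBracket (-1) sBarD)).smul u) hD
      (isRep_dunkl ?_ ?_ hD ?_)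
  · intro j i l
    rw [smul_mul_assoc, add_mul, reflBracket_mul_c hr, reflBracket_mul_c hr', ← smul_add, ← mul_add,
      mul_smul_comm, smul_comm]
  · exact (isEquivariant_reflBracket_s_add_sBar (r := sD) (r' := sBarD) (fun _ _ => rfl)
      fun _ _ => rfl).smul u
  · intro Y hY
    simpa only [map_smul, map_add] using
      ((hY.jacobi_reflBracket hr).add (hY.jacobi_reflBracket hr')).smul u

theorem realizedBy_typeB (u v : ℂ) (ρ : K (weylB n) →ₐ[ℂ] Module.End ℂ M) :
    RealizedBy (commB n u v) ρ fun i f m =>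
      -(u • ∑ k with k ≠ i, (divS i k f ⊗ₜ[ℂ] ρ (K.w (sB k i)) m +
        divSBar i k f ⊗ₜ[ℂ] ρ (K.c k * K.c i * K.w (sB k i)) m)) -
      u • ∑ k with k ≠ i, (divSBar i k f ⊗ₜ[ℂ] ρ (K.w (sBarB k i)) m -
        divS i k f ⊗ₜ[ℂ] ρ (K.c k * K.c i * K.w (sBarB k i)) m) -
      (((√2 : ℝ) : ℂ) * v) • (divTau i f ⊗ₜ[ℂ] ρ (K.w (tauB i)) m) := by
  have hr : IsReflFamily 1 (sB (n := n)) := .s fun _ _ => rfl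
  have hr' : IsReflFamily (-1) (sBarB (n := n)) := .sBar fun _ _ => rfl
  have hD (i : Fin n) : IsDunkl ρ (fun l => u • (reflBracket 1 K.c (fun k i => K.w (sB k i)) i l +
      reflBracket (-1) K.c (fun k i => K.w (sBarB k i)) i l) +
      (-(((√2 : ℝ) : ℂ) * v)) • diagBracket (fun i => K.w (tauB i)) i l) fun f m =>
      -(u • ∑ k with k ≠ i, (divS i k f ⊗ₜ[ℂ] ρ (K.w (sB k i)) m +
        divSBar i k f ⊗ₜ[ℂ] ρ (K.c k * K.c i * K.w (sB k i)) m)) -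
      u • ∑ k with k ≠ i, (divSBar i k f ⊗ₜ[ℂ] ρ (K.w (sBarB k i)) m -
        divS i k f ⊗ₜ[ℂ] ρ (K.c k * K.c i * K.w (sBarB k i)) m) -
      (((√2 : ℝ) : ℂ) * v) • (divTau i f ⊗ₜ[ℂ] ρ (K.w (tauB i)) m) := by
    have h := (((isDunkl_s (ρ := ρ) (r := sB) (fun _ _ => rfl)
      (fun i k f => by rw [← polyAct_sBar, divSBar_spec]) i).add
        (isDunkl_sBar (r := sBarB) (fun _ _ => rfl) i)).smul u).add
          ((isDunkl_diagBracket (t := tauB) (fun _ => rfl) i).smul (-(((√2 : ℝ) : ℂ) * v)))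
    exact h.congr (fun _ => rfl) fun f m => smul_neg_add_neg_add_neg_smul u _ _ _ _
  rw [commB_eq]
  refine realizedBy_of_isRep
    ((((isCommValue_reflBracket 1 sB).add (isCommValue_reflBracket (-1) sBarB)).smul u).add
      ((isCommValue_diagBracket tauB).smul _)) hD (isRep_dunkl ?_ ?_ hD ?_)
  · intro j i l
    rw [add_mul, smul_mul_assoc, smul_mul_assoc, add_mul, reflBracket_mul_c hr,
      reflBracket_mul_c hr', diagBracket_tau_mul_c (fun _ => rfl), ← smul_add, ← mul_add,
      smul_comm u, smul_comm (-(((√2 : ℝ) : ℂ) * v)), ← smul_add, ← mul_smul_comm, ← mul_smul_comm,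
      ← mul_add]
  · exact ((isEquivariant_reflBracket_s_add_sBar (r := sB) (r' := sBarB) (fun _ _ => rfl)
      fun _ _ => rfl).smul u).add ((isEquivariant_diagBracket fun _ => rfl).smul _)
  · intro Y hY
    simpa only [map_smul, map_add] using
      (((hY.jacobi_reflBracket hr).add (hY.jacobi_reflBracket hr')).smul u).add
        ((hY.jacobi_diagBracket (t := tauB) fun _ => rfl).smul (-(((√2 : ℝ) : ℂ) * v)))

end

end DaHCa

theorem mainTheorem9 (n : ℕ) {M : Type*} [AddCommGroup M] [Module ℂ M] :
    -- type `A_{n-1}`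
    (∀ (u : ℂ) (ρ : DaHCa.K (DaHCa.weylA n) →ₐ[ℂ] Module.End ℂ M),
      DaHCa.RealizedBy (DaHCa.commA n u) ρ fun i f m =>
        -(u • ∑ k with k ≠ i,
          (DaHCa.divS i k f ⊗ₜ[ℂ] ρ (DaHCa.K.w (DaHCa.sA k i)) m
            + DaHCa.divTwist i k f ⊗ₜ[ℂ]
                ρ (DaHCa.K.c k * DaHCa.K.c i * DaHCa.K.w (DaHCa.sA k i)) m))) ∧
    -- type `B_n`
    (∀ (u v : ℂ) (ρ : DaHCa.K (DaHCa.weylB n) →ₐ[ℂ] Module.End ℂ M),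
      DaHCa.RealizedBy (DaHCa.commB n u v) ρ fun i f m =>
        -(u • ∑ k with k ≠ i,
          (DaHCa.divS i k f ⊗ₜ[ℂ] ρ (DaHCa.K.w (DaHCa.sB k i)) m
            + DaHCa.divSBar i k f ⊗ₜ[ℂ]
                ρ (DaHCa.K.c k * DaHCa.K.c i * DaHCa.K.w (DaHCa.sB k i)) m))
        - u • ∑ k with k ≠ i,
          (DaHCa.divSBar i k f ⊗ₜ[ℂ] ρ (DaHCa.K.w (DaHCa.sBarB k i)) m
            - DaHCa.divS i k f ⊗ₜ[ℂ]
                ρ (DaHCa.K.c k * DaHCa.K.c i * DaHCa.K.w (DaHCa.sBarB k i)) m)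
        - (((√2 : ℝ) : ℂ) * v) •
            (DaHCa.divTau i f ⊗ₜ[ℂ] ρ (DaHCa.K.w (DaHCa.tauB i)) m)) ∧
    -- type `D_n`
    (∀ (u : ℂ) (ρ : DaHCa.K (DaHCa.weylD n) →ₐ[ℂ] Module.End ℂ M),
      DaHCa.RealizedBy (DaHCa.commD n u) ρ fun i f m =>
        -(u • ∑ k with k ≠ i,
          (DaHCa.divS i k f ⊗ₜ[ℂ] ρ (DaHCa.K.w (DaHCa.sD k i)) m
            + DaHCa.divSBar i k f ⊗ₜ[ℂ]
                ρ (DaHCa.K.c k * DaHCa.K.c i * DaHCa.K.w (DaHCa.sD k i)) m))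
        - u • ∑ k with k ≠ i,
          (DaHCa.divSBar i k f ⊗ₜ[ℂ] ρ (DaHCa.K.w (DaHCa.sBarD k i)) m
            - DaHCa.divS i k f ⊗ₜ[ℂ]
                ρ (DaHCa.K.c k * DaHCa.K.c i * DaHCa.K.w (DaHCa.sBarD k i)) m)) :=
  ⟨DaHCa.realizedBy_typeA, DaHCa.realizedBy_typeB, DaHCa.realizedBy_typeD⟩
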